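/- Let $R$ be a commutative local ring with infinite residue field, equipped with an involution $r \mapsto \overline{r}$ (possibly the identity). Let $\epsilon \in R$ satisfy $\epsilon\overline{\epsilon} = 1$, and let $\Lambda$ be a form parameter, i.e. an additive subgroup of $R$ with $\{r - \epsilon\overline{r} : r \in R\} \subseteq \Lambda \subseteq \{r \in R : \epsilon\overline{r} = -r\}$ and $\overline{r}\Lambda r \subseteq \Lambda$ for all $r \in R$. For $n \ge 0$ equip $R^{2n}$ with the hyperbolic forms $$h(x,y) = \sum_{i=1}^n \left(\overline{x_{2i-1}}\,y_{2i} + \epsilon\,\overline{x_{2i}}\,y_{2i-1}\right) \in R, \qquad q(x) = \sum_{i=1}^n \overline{x_{2i-1}}\,x_{2i} \bmod \Lambda \in R/\Lambda .$$ Let $\mathcal{IU}(R^{2n})$ be the set of all finite sequences $(v_0,\dots,v_k)$, $k \ge 0$, of vectors of $R^{2n}$ that form a basis of a free direct summand of $R^{2n}$ and satisfy $q(v_i) = 0$ and $h(v_i,v_j) = 0$ for all $i,j$, partially ordered by the subsequence relation. Let $C_k$ be the free abelian group on the sequences in $\mathcal{IU}(R^{2n})$ of length $k+1$ for $k \ge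 0$, let $C_{-1} = \mathbb{Z}$, and consider the differentials $\partial_k(v_0,\dots,v_k) = \sum_{i=0}^k (-1)^i (v_0,\dots,\widehat{v_i},\dots,v_k)$ for $k \ge 1$ and $\partial_0(v_0) = 1$. Then $\mathcal{IU}(R^{2n})$ is $(n-2)$-acyclic, that is, $\ker \partial_k = \operatorname{im} \partial_{k+1}$ in $C_k$ for all $0 \le k \le n-2$. -/

import Mathlib

/-! ## The poset of ordered sequences -/

/-- `OrdSeq S` is the set `𝒪(S)` of finite ordered sequences `(v_0, …, v_dim)` of pairwise distinct
elements of `S`, of length `dim + 1 ≥ 1`. -/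
structure OrdSeq (S : Type*) where
  /-- the length of the sequence, minus one -/
  dim : ℕ
  /-- the entries -/
  seq : Fin (dim + 1) ↪ S

/-- `v ≤ w` if and only if `v` is a subsequence of `w`. -/
instance OrdSeq.instPartialOrder (S : Type*) : PartialOrder (OrdSeq S) where
  le v w := ∃ f : Fin (v.dim + 1) → Fin (w.dim + 1), StrictMono f ∧ ∀ i, v.seq i = w.seq (f i)
  le_refl v := ⟨id, strictMono_id, fun _ => rfl⟩
  le_trans u v w := by
    rintro ⟨f, hf, h⟩ ⟨g, hg, h'⟩
    exact ⟨g ∘ f, hg.comp hf, fun i => by rw [h i, h' (f i)]; rfl⟩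
  le_antisymm := by
    rintro ⟨k, v⟩ ⟨l, w⟩ ⟨f, hf, h⟩ ⟨g, hg, -⟩
    have h1 : k + 1 ≤ l + 1 := by simpa using Fintype.card_le_of_injective f hf.injective
    have h2 : l + 1 ≤ k + 1 := by simpa using Fintype.card_le_of_injective g hg.injective
    obtain rfl : k = l := by omega
    have hid : f = id := by
      have hr : ∀ (a : Fin (k + 1) ≃o Fin (k + 1)), ∀ i, a i = i := fun a i => by
        rw [Subsingleton.elim a (OrderIso.refl _)]; rfl
      funext i
      exact hr (hf.orderIsoOfSurjective f (Finite.surjective_of_injective hf.injective)) i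
    subst hid
    congr
    ext i
    exact h i

/-! ## The augmented chain complex of a poset of ordered sequences

A subset `X` of `𝒪(S)` satisfying the chain condition (subsequences of members are members) is a
lower set of the poset `𝒪(S)`. -/

section Complex

variable {S : Type*}

/-- The `k`-simplices of `X`: the members of `X` of length `k + 1`. -/
def FrameSimplex (X : LowerSet (OrdSeq S)) (k : ℕ) : Type _ :=
  {v : Fin (k + 1) ↪ S // OrdSeq.mk k v ∈ X}

/-- The face `d_i`, which omits the entry `v_i`. -/
def FrameSimplex.face {X : LowerSet (OrdSeq S)} {k : ℕ} (v : FrameSimplex X (k + 1))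
    (i : Fin (k + 2)) : FrameSimplex X k :=
  ⟨(Fin.succAboveEmb i).trans v.1,
    X.lower ⟨i.succAbove, Fin.strictMono_succAbove i, fun _ => rfl⟩ v.2⟩

/-- `C_k(X)` for `k ≥ 0`: the free abelian group on the `k`-simplices of `X`. -/
abbrev FrameChain (X : LowerSet (OrdSeq S)) (k : ℕ) : Type _ := FrameSimplex X k →₀ ℤ

/-- `∂_0 : C_0(X) → C_{-1}(X) = ℤ`, `∑ n_i v_i ↦ ∑ n_i`. -/
noncomputable def frameAugmentation (X : LowerSet (OrdSeq S)) : FrameChain X 0 →ₗ[ℤ] ℤ :=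
  Finsupp.linearCombination ℤ (fun _ => (1 : ℤ))

/-- `∂_{k+1} = ∑ (-1)^i d_i : C_{k+1}(X) → C_k(X)`. -/
noncomputable def frameBoundary (X : LowerSet (OrdSeq S)) (k : ℕ) :
    FrameChain X (k + 1) →ₗ[ℤ] FrameChain X k :=
  Finsupp.linearCombination ℤ
    (fun v => ∑ i : Fin (k + 2), (-1 : ℤ) ^ (i : ℕ) • Finsupp.single (v.face i) (1 : ℤ))

/-- The `k`-cycles, i.e. the kernel of `∂_k`. -/
noncomputable def frameCycles (X : LowerSet (OrdSeq S)) : (k : ℕ) → Submodule ℤ (FrameChain X k)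
  | 0 => LinearMap.ker (frameAugmentation X)
  | k + 1 => LinearMap.ker (frameBoundary X k)

/-- The `k`-boundaries, i.e. the image of `∂_{k+1}`. -/
noncomputable def frameBoundaries (X : LowerSet (OrdSeq S)) (k : ℕ) :
    Submodule ℤ (FrameChain X k) :=
  LinearMap.range (frameBoundary X k)

theorem FrameSimplex.face_face {X : LowerSet (OrdSeq S)} {k : ℕ} (v : FrameSimplex X (k + 2))
    (i : Fin (k + 3)) (j : Fin (k + 2)) :
    (v.face (i.succAbove j)).face (j.predAbove i) = (v.face i).face j := by
  apply Subtype.ext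
  ext l
  exact congrArg v.1 (Fin.succAbove_succAbove_succAbove_predAbove i j l)

/-- `∂ ∘ ∂ = 0`: boundaries are cycles. -/
theorem frameBoundaries_le_frameCycles (X : LowerSet (OrdSeq S)) (k : ℕ) :
    frameBoundaries X k ≤ frameCycles X k := by
  rintro _ ⟨c, rfl⟩
  cases k with
  | zero =>
    have : frameAugmentation X ∘ₗ frameBoundary X 0 = 0 := by
      ext v
      simp [frameAugmentation, frameBoundary, Fin.sum_univ_two]
    exact LinearMap.congr_fun this c
  | succ k =>
    have : frameBoundary X k ∘ₗ frameBoundary X (k + 1) = 0 := by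
      apply Finsupp.lhom_ext'
      intro v
      apply LinearMap.ext_ring
      have e : (frameBoundary X k ∘ₗ frameBoundary X (k + 1)) (Finsupp.single v 1) =
          ∑ p : Fin (k + 3) × Fin (k + 2), (-1 : ℤ) ^ ((p.1 : ℕ) + (p.2 : ℕ)) •
            Finsupp.single ((v.face p.1).face p.2) (1 : ℤ) := by
        rw [Fintype.sum_prod_type]
        simp only [LinearMap.comp_apply, frameBoundary, Finsupp.linearCombination_single, one_mul,
          map_sum, map_smul, Finset.smul_sum, smul_smul, pow_add]
      have z : ∑ p : Fin (k + 3) × Fin (k + 2), (-1 : ℤ) ^ ((p.1 : ℕ) + (p.2 : ℕ)) •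
            Finsupp.single ((v.face p.1).face p.2) (1 : ℤ) = 0 := by
        refine Finset.sum_involution (fun p _ => (p.1.succAbove p.2, p.2.predAbove p.1)) ?_ ?_ ?_ ?_
        · rintro ⟨i, j⟩ -
          simp only [FrameSimplex.face_face, Fin.neg_one_pow_succAbove_add_predAbove, neg_smul,
            add_neg_cancel]
        · rintro ⟨i, j⟩ - - h
          exact Fin.succAbove_ne i j (congrArg Prod.fst h)
        · intros
          exact Finset.mem_univ _
        · rintro ⟨i, j⟩ -
          simp [Fin.succAbove_succAbove_predAbove, Fin.predAbove_predAbove_succAbove]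
      exact e.trans z
    exact LinearMap.congr_fun this c

/-- The homology group `H̃_k(X, ℤ) = H_k(C_*(X))` of the augmented complex, for `k ≥ 0`. -/
abbrev FrameHomology (X : LowerSet (OrdSeq S)) (k : ℕ) : Type _ :=
  frameCycles X k ⧸ (frameBoundaries X k).submoduleOf (frameCycles X k)

/-- `X` is `m`-acyclic if `H̃_k(X, ℤ) = 0` for all `0 ≤ k ≤ m`. -/
def IsFrameAcyclic (X : LowerSet (OrdSeq S)) (m : ℤ) : Prop :=
  ∀ k : ℕ, (k : ℤ) ≤ m → Subsingleton (FrameHomology X k)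

end Complex

/-! ## Unimodular sequences -/

/-- A family of vectors is unimodular if it is a basis of a free direct summand. -/
def IsUnimodularSeq (R : Type*) {M ι : Type*} [Ring R] [AddCommGroup M] [Module R M]
    (v : ι → M) : Prop :=
  LinearIndependent R v ∧ ∃ Q : Submodule R M, IsCompl (Submodule.span R (Set.range v)) Q

theorem IsUnimodularSeq.comp {R M ι κ : Type*} [Ring R] [AddCommGroup M] [Module R M]
    {v : ι → M} (hv : IsUnimodularSeq R v) (f : κ → ι) (hf : Function.Injective f) :
    IsUnimodularSeq R (v ∘ f) := by
  obtain ⟨hi, Q, hQ⟩ := hv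
  refine ⟨hi.comp f hf, Submodule.span R (v '' (Set.range f)ᶜ) ⊔ Q, ?_⟩
  have hsup : Submodule.span R (Set.range (v ∘ f)) ⊔ Submodule.span R (v '' (Set.range f)ᶜ) =
      Submodule.span R (Set.range v) := by
    rw [Set.range_comp, ← Submodule.span_union, ← Set.image_union, Set.union_compl_self,
      Set.image_univ]
  constructor
  · apply Disjoint.disjoint_sup_right_of_disjoint_sup_left
    · rw [Set.range_comp]
      exact hi.disjoint_span_image disjoint_compl_right
    · rw [hsup]
      exact hQ.disjoint
  · rw [codisjoint_iff, ← sup_assoc, hsup]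
    exact hQ.codisjoint.eq_top

/-! ## Hyperbolic spaces -/

/-- A form parameter relative to the involution `star` of the commutative ring `R` and `ε`:
an additive subgroup `Λ` with `{r - ε r̄} ⊆ Λ ⊆ {r | ε r̄ = -r}` and `r̄ Λ r ⊆ Λ` for all `r`. -/
structure FormParameter (R : Type*) [CommRing R] [StarRing R] (ε : R) extends AddSubgroup R where
  sub_mem' : ∀ r : R, r - ε * star r ∈ carrier
  mul_star_eq' : ∀ r ∈ carrier, ε * star r = -r
  star_mul_mul_mem' : ∀ r a : R, a ∈ carrier → star r * a * r ∈ carrier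

section Hyperbolic

variable {R : Type*} [CommRing R] [StarRing R]

/-- The first index `2i` (counting from `0`) of the `i`-th hyperbolic pair of coordinates. -/
def hypFst {n : ℕ} (i : Fin n) : Fin (2 * n) := ⟨2 * i, by omega⟩

/-- The second index `2i + 1` (counting from `0`) of the `i`-th hyperbolic pair of coordinates. -/
def hypSnd {n : ℕ} (i : Fin n) : Fin (2 * n) := ⟨2 * i + 1, by omega⟩

/-- The `ε`-hermitian form on `R^{2n}`; with coordinates numbered `1, …, 2n` it is
`h(x, y) = ∑_{i=1}^n (x̄_{2i-1} y_{2i} + ε x̄_{2i} y_{2i-1})`. -/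
def hypForm (ε : R) {n : ℕ} (x y : Fin (2 * n) → R) : R :=
  ∑ i : Fin n, (star (x (hypFst i)) * y (hypSnd i) + ε * star (x (hypSnd i)) * y (hypFst i))

/-- The quadratic map `q : R^{2n} → R / Λ`; with coordinates numbered `1, …, 2n` it is
`q(x) = ∑_{i=1}^n x̄_{2i-1} x_{2i} mod Λ`. -/
def hypQuad {ε : R} (Λ : FormParameter R ε) {n : ℕ} (x : Fin (2 * n) → R) : R ⧸ Λ.toAddSubgroup :=
  QuotientAddGroup.mk (∑ i : Fin n, star (x (hypFst i)) * x (hypSnd i))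

/-- A family of vectors of the hyperbolic space `(R^{2n}, h, q)` is isotropic if `q` vanishes on
each of its members and `h` vanishes on each pair of its members. -/
def IsIsotropicSeq {ε : R} (Λ : FormParameter R ε) {n : ℕ} {ι : Type*}
    (v : ι → (Fin (2 * n) → R)) : Prop :=
  (∀ i, hypQuad Λ (v i) = 0) ∧ ∀ i j, hypForm ε (v i) (v j) = 0

/-- The poset `ℐ𝒰(R^{2n})` of isotropic unimodular frames: the sequences `(v_0, …, v_k)` in
`R^{2n}` which are isotropic and form a basis of a free direct summand of `R^{2n}`. -/
def isotropicUnimodularPoset {ε : R} (Λ : FormParameter R ε) (n : ℕ) :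
    LowerSet (OrdSeq (Fin (2 * n) → R)) where
  carrier := {v | IsUnimodularSeq R v.seq ∧ IsIsotropicSeq Λ v.seq}
  lower' := by
    rintro w v ⟨f, hf, h⟩ ⟨hu, hq, hh⟩
    have e : (v.seq : Fin (v.dim + 1) → (Fin (2 * n) → R)) = w.seq ∘ f := funext h
    refine ⟨?_, ?_, ?_⟩
    · rw [e]
      exact hu.comp f hf.injective
    · intro i
      rw [h i]
      exact hq _
    · intro i j
      rw [h i, h j]
      exact hh _ _

end Hyperbolic

/-! A cycle in degree `k ≤ n - 2` involves only finitely many frames, each with at most `n - 1`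
entries. It is coned off with vectors of one Lagrangian `L`: a totally isotropic submodule of half
dimension modulo the maximal ideal `𝔪`, chosen so that its reduction meets the reduced span of every
subframe `v` of the support only in `0`.

Consider frames `u ++ v` with `u` in `L`, `v` fixed and `|u| + |v| < n`. By transversality and
Nakayama, the vectors of `L` orthogonal to `v` reduce onto a space of dimension at least `n - |v| >
|u|`, and this space is not contained in the reduced span of `u ++ v`. As the residue field is
infinite, one vector `w` of `L` extends finitely many such frames at once
(`IsLagrangian.exists_forall_isFrameList_cons`). The apex `w` depends on `v`, so no single cone is
available. Instead, coning off the frames with the largest number of entries outside `L` changes the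
cycle by a boundary and lowers that number; induction finishes (`exists_listBoundary_eq`).

The Lagrangian is found by starting from a coordinate one and passing repeatedly to an adjacent one
`(L ∩ x^⊥) + R x`. For isotropic `x` in general position, each step lowers all nonzero intersections
simultaneously (`IsLagrangian.exists_finrank_inf_le`). Such `x` exist in hyperbolic rank at least
`2` (`exists_hypQuad_eq_zero_forall_hypForm`), which is all that `0 ≤ k ≤ n - 2` requires. Over a
local ring unimodularity is linear independence modulo `𝔪`, so the dimension counts take place over
the residue field. -/

/-! ## Chains of lists -/

section ListChains

variable {S : Type*}

/-- Prepending `w` to every list of a chain. -/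
noncomputable def listCons (w : S) : (List S →₀ ℤ) →ₗ[ℤ] (List S →₀ ℤ) :=
  Finsupp.lmapDomain ℤ ℤ (fun l => w :: l)

/-- The alternating sum of the faces of a list. -/
noncomputable def listFaces : List S → (List S →₀ ℤ)
  | [] => 0
  | a :: l => Finsupp.single l 1 - listCons a (listFaces l)

/-- The simplicial boundary on chains of lists. -/
noncomputable def listBoundary : (List S →₀ ℤ) →ₗ[ℤ] (List S →₀ ℤ) :=
  Finsupp.linearCombination ℤ listFaces

@[simp]
theorem listCons_single (w : S) (l : List S) (a : ℤ) :
    listCons w (Finsupp.single l a) = Finsupp.single (w :: l) a := by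
  simp [listCons]

@[simp]
theorem listBoundary_single_one (l : List S) :
    listBoundary (Finsupp.single l 1) = listFaces l := by
  simp [listBoundary]

/-- Coning with a fixed apex is a contracting homotopy, in all degrees including that of the empty
list. -/
theorem listBoundary_listCons (w : S) (c : List S →₀ ℤ) :
    listBoundary (listCons w c) = c - listCons w (listBoundary c) := by
  have : listBoundary ∘ₗ listCons w = LinearMap.id - listCons w ∘ₗ listBoundary := by
    ext1 l
    ext1
    simp [listFaces]
  exact LinearMap.congr_fun this c

theorem listBoundary_listFaces (l : List S) : listBoundary (listFaces l) = 0 := by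
  induction l with
  | nil => simp [listFaces]
  | cons a l ih => simp [listFaces, listBoundary_listCons, ih]

theorem listBoundary_listBoundary (c : List S →₀ ℤ) : listBoundary (listBoundary c) = 0 := by
  have : listBoundary ∘ₗ listBoundary = (0 : (List S →₀ ℤ) →ₗ[ℤ] (List S →₀ ℤ)) := by
    ext1 l
    ext1
    simp [listBoundary_listFaces]
  exact LinearMap.congr_fun this c

/-- To map `supported A` into `Q` it suffices to map the generators in `A` into `Q`. -/
theorem map_mem_of_mem_supported {N : Type*} [AddCommGroup N] {ι : Type*} {A : Set ι}
    {Q : Submodule ℤ N} {f : (ι →₀ ℤ) →ₗ[ℤ] N} (h : ∀ l ∈ A, f (Finsupp.single l 1) ∈ Q)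
    {c : ι →₀ ℤ} (hc : c ∈ Finsupp.supported ℤ ℤ A) : f c ∈ Q := by
  rw [Finsupp.supported_eq_span_single] at hc
  have : Submodule.span ℤ ((fun i => Finsupp.single i (1 : ℤ)) '' A) ≤ Q.comap f := by
    rw [Submodule.span_le]
    rintro _ ⟨l, hl, rfl⟩
    exact h l hl
  exact this hc

theorem listFaces_mem_supported (l : List S) :
    listFaces l ∈ Finsupp.supported ℤ ℤ {l' : List S | l'.Sublist l ∧ l'.length + 1 = l.length} := by
  induction l with
  | nil => simp [listFaces]
  | cons a l ih =>
    refine Submodule.sub_mem _ (Finsupp.single_mem_supported ℤ _ ⟨List.sublist_cons_self a l, rfl⟩)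
      (map_mem_of_mem_supported (fun l' hl' => ?_) ih)
    rw [listCons_single]
    exact Finsupp.single_mem_supported ℤ _ ⟨hl'.1.cons_cons a, by simpa using hl'.2⟩

open Classical in
/-- Let `G` be a set of lists that is closed under sublists, and suppose that the members of `G`
of length `m` that have the same entries outside `P` can be coned off simultaneously by an element
of `P`. Then the cycles on the members of `G` of length `m` are boundaries. -/
theorem exists_listBoundary_eq {G : Set (List S)} (P : S → Prop) (m : ℕ)
    (hG : ∀ l ∈ G, ∀ l' : List S, l'.Sublist l → l' ∈ G)
    (hcone : ∀ (v : List S) (T : Finset (List S)),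
      (∀ l ∈ T, l ∈ G ∧ l.length = m ∧ l.filter (fun x => ¬ P x) = v) →
        ∃ w, P w ∧ ∀ l ∈ T, w :: l ∈ G)
    {c : List S →₀ ℤ} (hc : c ∈ Finsupp.supported ℤ ℤ {l | l ∈ G ∧ l.length = m})
    (hc0 : listBoundary c = 0) :
    ∃ y ∈ Finsupp.supported ℤ ℤ {l | l ∈ G ∧ l.length = m + 1}, listBoundary y = c := by
  set vp : List S → List S := fun l => l.filter (fun x => ¬ P x) with hvp
  -- Induction on a strict bound `b` for the number of entries outside `P`; for `b = 0` the chain is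
  -- zero.
  suffices H : ∀ (b : ℕ) (c : List S →₀ ℤ),
      c ∈ Finsupp.supported ℤ ℤ {l | (l ∈ G ∧ l.length = m) ∧ (vp l).length < b} →
      listBoundary c = 0 →
      ∃ y ∈ Finsupp.supported ℤ ℤ {l | l ∈ G ∧ l.length = m + 1}, listBoundary y = c by
    refine H (m + 1) c (Finsupp.supported_mono ?_ hc) hc0
    rintro l ⟨hl, rfl⟩
    exact ⟨⟨hl, rfl⟩, Nat.lt_succ_of_le (List.length_filter_le _ _)⟩
  intro b
  induction b with
  | zero =>
    intro c hc _
    refine ⟨0, zero_mem _, ?_⟩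
    simpa [eq_comm] using hc
  | succ b ih =>
    intro c hc hc0
    have hT : ∀ v : List S, ∃ w, P w ∧ ∀ l ∈ c.support.filter (fun l => vp l = v), w :: l ∈ G := by
      intro v
      refine hcone v _ fun l hl => ?_
      obtain ⟨h1, h2⟩ := Finset.mem_filter.1 hl
      have := (Finsupp.mem_supported ℤ c).1 hc h1
      exact ⟨this.1.1, this.1.2, h2⟩
    choose w hwP hw using hT
    -- Only the top stratum is coned off, with an apex depending only on the entries outside `P`.
    set κ : (List S →₀ ℤ) →ₗ[ℤ] (List S →₀ ℤ) := Finsupp.linearCombination ℤ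
      (fun l => if (vp l).length = b then Finsupp.single (w (vp l) :: l) 1 else 0) with hκ
    have hκs : ∀ l, κ (Finsupp.single l 1) =
        if (vp l).length = b then Finsupp.single (w (vp l) :: l) 1 else 0 := by
      intro l; simp [hκ]
    have hcs : c ∈ Finsupp.supported ℤ ℤ (c.support : Set (List S)) :=
      (Finsupp.mem_supported ℤ c).2 subset_rfl
    have hmem : ∀ l ∈ (c.support : Set (List S)),
        (l ∈ G ∧ l.length = m) ∧ (vp l).length < b + 1 ∧ w (vp l) :: l ∈ G := by
      intro l hl
      have := (Finsupp.mem_supported ℤ c).1 hc hl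
      exact ⟨this.1, this.2, hw _ l (Finset.mem_filter.2 ⟨hl, rfl⟩)⟩
    have hy : κ c ∈ Finsupp.supported ℤ ℤ {l | l ∈ G ∧ l.length = m + 1} := by
      refine map_mem_of_mem_supported (fun l hl => ?_) hcs
      rw [hκs]
      split_ifs
      · exact Finsupp.single_mem_supported ℤ _ ⟨(hmem l hl).2.2, by simp [(hmem l hl).1.2]⟩
      · exact zero_mem _
    -- As `c` is a cycle, this operator sends it to the homologous cycle `c - ∂ κ c`; on generators
    -- it can be seen to leave the top stratum.
    have hlow : (LinearMap.id - listBoundary ∘ₗ κ - κ ∘ₗ listBoundary :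
        (List S →₀ ℤ) →ₗ[ℤ] (List S →₀ ℤ)) c ∈
        Finsupp.supported ℤ ℤ {l | (l ∈ G ∧ l.length = m) ∧ (vp l).length < b} := by
      refine map_mem_of_mem_supported (fun l hl => ?_) hcs
      obtain ⟨⟨hlG, hlm⟩, hlb, hwl⟩ := hmem l hl
      simp only [LinearMap.sub_apply, LinearMap.id_apply, LinearMap.comp_apply,
        listBoundary_single_one, hκs]
      split_ifs with hb
      · have e : Finsupp.single l 1 - listBoundary (Finsupp.single (w (vp l) :: l) 1) -
            κ (listFaces l) = (listCons (w (vp l)) - κ) (listFaces l) := by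
          simp [listFaces]
        rw [e]
        refine map_mem_of_mem_supported (fun l' hl' => ?_) (listFaces_mem_supported l)
        obtain ⟨hs, hlen⟩ := hl'
        have hvs : (vp l').Sublist (vp l) := hs.filter _
        rw [LinearMap.sub_apply, listCons_single, hκs]
        split_ifs with hb'
        -- A face that keeps all `b` entries outside `P` has the same apex, so its two cones cancel.
        · rw [hvs.eq_of_length (hb'.trans hb.symm), sub_self]
          exact zero_mem _
        · rw [sub_zero]
          refine Finsupp.single_mem_supported ℤ _ ⟨⟨hG _ hwl _ (hs.cons_cons _), ?_⟩, ?_⟩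
          · simpa using hlen.trans hlm
          · have : vp (w (vp l) :: l') = vp l' := by simp [hvp, hwP]
            rw [this]
            exact lt_of_le_of_ne (hb ▸ hvs.length_le) hb'
      · rw [map_zero, sub_zero]
        have : κ (listFaces l) = 0 := by
          have := map_mem_of_mem_supported (f := κ) (Q := ⊥) (fun l' hl' => ?_)
            (listFaces_mem_supported l)
          · simpa using this
          · obtain ⟨hs, hlen⟩ := hl'
            have hvs : (vp l').Sublist (vp l) := hs.filter _
            rw [hκs, if_neg]
            · exact zero_mem _
            · have := hvs.length_le
              omega
        rw [this, sub_zero]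
        exact Finsupp.single_mem_supported ℤ _ ⟨⟨hlG, hlm⟩, by omega⟩
    simp only [LinearMap.sub_apply, LinearMap.id_apply, LinearMap.comp_apply, hc0, map_zero,
      sub_zero] at hlow
    obtain ⟨y, hyG, hyc⟩ := ih _ hlow (by
      rw [map_sub, hc0, listBoundary_listBoundary, sub_zero])
    exact ⟨y + κ c, add_mem hyG hy, by rw [map_add, hyc, sub_add_cancel]⟩

end ListChains

/-! ## Comparison with chains of frames -/

section Comparison

variable {S : Type*} {X : LowerSet (OrdSeq S)}

/-- The list of entries of a simplex. -/
def FrameSimplex.toList {k : ℕ} (v : FrameSimplex X k) : List S := List.ofFn v.1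

theorem FrameSimplex.toList_injective (k : ℕ) :
    Function.Injective (FrameSimplex.toList : FrameSimplex X k → List S) := by
  intro v w h
  exact Subtype.ext (DFunLike.coe_injective (List.ofFn_injective h))

/-- A chain of frames as a chain of lists. -/
noncomputable def frameChainToList (X : LowerSet (OrdSeq S)) (k : ℕ) :
    FrameChain X k →ₗ[ℤ] (List S →₀ ℤ) :=
  Finsupp.lmapDomain ℤ ℤ FrameSimplex.toList

theorem frameChainToList_injective (k : ℕ) : Function.Injective (frameChainToList X k) :=
  Finsupp.mapDomain_injective (FrameSimplex.toList_injective k)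

theorem listFaces_ofFn {k : ℕ} (v : Fin (k + 1) → S) :
    listFaces (List.ofFn v) =
      ∑ i : Fin (k + 1), (-1 : ℤ) ^ (i : ℕ) • Finsupp.single (List.ofFn (v ∘ i.succAbove)) 1 := by
  induction k with
  | zero => simp [listFaces]
  | succ k ih =>
    rw [List.ofFn_succ, listFaces, ih, map_sum, Fin.sum_univ_succ (n := k + 1), sub_eq_add_neg,
      ← Finset.sum_neg_distrib]
    congr 1
    · simp [Function.comp_def]
    · refine Finset.sum_congr rfl fun i _ => ?_
      rw [map_smul, listCons_single, List.ofFn_succ]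
      simp [Function.comp_def, pow_succ]

theorem listBoundary_frameChainToList (k : ℕ) (c : FrameChain X (k + 1)) :
    listBoundary (frameChainToList X (k + 1) c) = frameChainToList X k (frameBoundary X k c) := by
  have : listBoundary ∘ₗ frameChainToList X (k + 1) =
      frameChainToList X k ∘ₗ frameBoundary X k := by
    ext1 v
    ext1
    simp only [LinearMap.comp_apply, Finsupp.lsingle_apply, frameChainToList, frameBoundary,
      Finsupp.lmapDomain_apply, Finsupp.mapDomain_single, listBoundary_single_one,
      Finsupp.linearCombination_single, one_smul]
    rw [FrameSimplex.toList, listFaces_ofFn, Finsupp.mapDomain_finsetSum]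
    refine Finset.sum_congr rfl fun i _ => ?_
    rw [Finsupp.mapDomain_smul, Finsupp.mapDomain_single]
    rfl
  exact LinearMap.congr_fun this c

/-- The empty list plays the role of the generator of `C_{-1} = ℤ`, so the augmentation needs no
separate treatment. -/
theorem listBoundary_frameChainToList_zero (c : FrameChain X 0) :
    listBoundary (frameChainToList X 0 c) = Finsupp.single [] (frameAugmentation X c) := by
  have : listBoundary ∘ₗ frameChainToList X 0 =
      Finsupp.lsingle [] ∘ₗ frameAugmentation X := by
    ext1 v
    ext1
    simp [frameChainToList, frameAugmentation, FrameSimplex.toList, listFaces]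
  exact LinearMap.congr_fun this c

theorem listBoundary_eq_zero_of_mem_frameCycles {k : ℕ} {c : FrameChain X k}
    (hc : c ∈ frameCycles X k) : listBoundary (frameChainToList X k c) = 0 := by
  cases k with
  | zero =>
    rw [listBoundary_frameChainToList_zero, LinearMap.mem_ker.1 hc, Finsupp.single_zero]
  | succ k =>
    rw [listBoundary_frameChainToList, LinearMap.mem_ker.1 hc, map_zero]

theorem mem_range_frameChainToList {k : ℕ} {y : List S →₀ ℤ}
    (hy : y ∈ Finsupp.supported ℤ ℤ (Set.range (FrameSimplex.toList : FrameSimplex X k → List S))) :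
    y ∈ LinearMap.range (frameChainToList X k) := by
  refine map_mem_of_mem_supported (f := LinearMap.id) ?_ hy
  rintro _ ⟨v, rfl⟩
  exact ⟨Finsupp.single v 1, by simp [frameChainToList]⟩

/-- A cycle bounds if it bounds as a chain of lists. -/
theorem mem_frameBoundaries_of_listBoundary_eq {k : ℕ} {c : FrameChain X k} {y : List S →₀ ℤ}
    (hy : y ∈ Finsupp.supported ℤ ℤ
      (Set.range (FrameSimplex.toList : FrameSimplex X (k + 1) → List S)))
    (h : listBoundary y = frameChainToList X k c) : c ∈ frameBoundaries X k := by
  obtain ⟨e, rfl⟩ := mem_range_frameChainToList hy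
  refine ⟨e, frameChainToList_injective k ?_⟩
  rw [← h, listBoundary_frameChainToList]

end Comparison

theorem isUnimodularSeq_of_leftInverse {R ι κ : Type*} [CommRing R] [Fintype κ]
    {v : κ → ι → R} (F : (ι → R) →ₗ[R] κ → R)
    (hF : ∀ c : κ → R, F (∑ j, c j • v j) = c) : IsUnimodularSeq R v := by
  have hmem : ∀ c : κ → R, ∑ j, c j • v j ∈ Submodule.span R (Set.range v) := fun c =>
    Submodule.sum_mem _ fun j _ => Submodule.smul_mem _ _ (Submodule.subset_span ⟨j, rfl⟩)
  refine ⟨?_, LinearMap.ker F, ?_, ?_⟩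
  · rw [Fintype.linearIndependent_iff]
    intro g hg j
    rw [← hF g, hg, map_zero, Pi.zero_apply]
  · rw [Submodule.disjoint_def]
    intro x hx hx0
    obtain ⟨c, rfl⟩ := (Submodule.mem_span_range_iff_exists_fun R).1 hx
    rw [LinearMap.mem_ker, hF] at hx0
    simp [hx0]
  · rw [codisjoint_iff, eq_top_iff]
    intro x _
    refine Submodule.mem_sup.2 ⟨_, hmem (F x), x - ∑ j, F x j • v j, ?_, by abel⟩
    rw [LinearMap.mem_ker, map_sub, hF, sub_self]

/-! ## Reduction modulo the maximal ideal -/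

section Reduction

open IsLocalRing

variable {R : Type*} [CommRing R] [IsLocalRing R]

instance residue_ringHomSurjective : RingHomSurjective (residue R) := ⟨residue_surjective⟩

/-- Reduction of vectors modulo the maximal ideal. -/
noncomputable def redMod (R : Type*) [CommRing R] [IsLocalRing R] (ι : Type*) :
    (ι → R) →ₛₗ[residue R] (ι → ResidueField R) where
  toFun x i := residue R (x i)
  map_add' _ _ := funext fun _ => map_add _ _ _
  map_smul' _ _ := funext fun _ => map_mul _ _ _

@[simp]
theorem redMod_apply {ι : Type*} (x : ι → R) (i : ι) : redMod R ι x i = residue R (x i) := rfl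

theorem redMod_surjective (ι : Type*) : Function.Surjective (redMod R ι) := fun y =>
  ⟨fun i => (residue_surjective (y i)).choose,
    funext fun i => (residue_surjective (y i)).choose_spec⟩

/-- Finitely many nonzero linear maps to an infinite residue field have a common non-zero. -/
theorem exists_forall_apply_ne_zero [Infinite (ResidueField R)] {M κ : Type*} [AddCommGroup M]
    [Module R M] (s : Finset κ) (f : κ → M →ₗ[R] ResidueField R)
    (h : ∀ j ∈ s, ∃ z, f j z ≠ 0) : ∃ z, ∀ j ∈ s, f j z ≠ 0 := by
  classical
  induction s using Finset.induction_on with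
  | empty => exact ⟨0, by simp⟩
  | insert j₀ s _ ih =>
    obtain ⟨z, hz⟩ := ih fun j hj => h j (Finset.mem_insert_of_mem hj)
    obtain ⟨z', hz'⟩ := h j₀ (Finset.mem_insert_self _ _)
    -- Along the line `z + t z'`, each functional not vanishing at `z'` excludes one residue of `t`;
    -- the others keep their nonzero value at `z`.
    obtain ⟨t', ht'⟩ := Infinite.exists_notMem_finset
      ((insert j₀ s).image fun j => -(f j z) / f j z')
    obtain ⟨t, rfl⟩ := residue_surjective t'
    refine ⟨z + t • z', fun j hj h0 => ?_⟩
    rw [map_add, map_smul, Algebra.smul_def, ResidueField.algebraMap_eq] at h0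
    by_cases hj' : f j z' = 0
    · rcases Finset.mem_insert.1 hj with rfl | hjs
      · exact hz' hj'
      · exact hz j hjs (by simpa [hj'] using h0)
    · refine ht' (Finset.mem_image.2 ⟨j, hj, ?_⟩)
      rw [div_eq_iff hj']
      linear_combination -h0

variable {ι κ : Type*} [Fintype ι] [Fintype κ]

theorem residue_linearMap_eq_zero (f : (ι → R) →ₗ[R] R) {x : ι → R} (hx : redMod R ι x = 0) :
    residue R (f x) = 0 := by
  classical
  rw [LinearMap.pi_apply_eq_sum_univ f x, map_sum]
  refine Finset.sum_eq_zero fun i _ => ?_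
  rw [smul_eq_mul, map_mul, ← redMod_apply, hx, Pi.zero_apply, zero_mul]

/-- The coordinates on the span extend to the whole module through the projection along the
complement. They take values in `𝔪` on a vector with zero reduction, so a relation modulo `𝔪` has
zero coefficients. -/
theorem IsUnimodularSeq.linearIndependent_redMod {v : κ → ι → R} (hv : IsUnimodularSeq R v) :
    LinearIndependent (ResidueField R) fun j => redMod R ι (v j) := by
  classical
  obtain ⟨hi, Q, hQ⟩ := hv
  let b := Module.Basis.span hi
  rw [Fintype.linearIndependent_iff]
  intro g hg j
  choose c hc using fun j => residue_surjective (g j)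
  have h0 : redMod R ι (∑ i, c i • v i) = 0 := by
    rw [map_sum, ← hg]
    exact Finset.sum_congr rfl fun i _ => by rw [LinearMap.map_smulₛₗ, hc]
  have h1 := residue_linearMap_eq_zero (b.coord j ∘ₗ Submodule.projectionOnto _ Q hQ) h0
  have h2 : ∀ i, Submodule.projectionOnto _ Q hQ (v i) = b i := by
    intro i
    have : v i = ((b i : Submodule.span R (Set.range v)) : ι → R) :=
      congrArg Subtype.val (Module.Basis.span_apply hi i).symm
    rw [this, Submodule.projectionOnto_apply_left]
  rw [← hc, ← h1]
  congr 1
  simp [h2, Finsupp.single_apply]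

/-- A left inverse over the residue field lifts to a matrix `A` with `A V ≡ 1` modulo `𝔪`. Then `A
V` is invertible and `(A V)⁻¹ A` is a left inverse of `V`. -/
theorem isUnimodularSeq_of_linearIndependent_redMod {v : κ → ι → R}
    (hv : LinearIndependent (ResidueField R) fun j => redMod R ι (v j)) :
    IsUnimodularSeq R v := by
  classical
  obtain ⟨P, hP⟩ := (Fintype.linearCombination (ResidueField R)
    fun j => redMod R ι (v j)).exists_leftInverse_of_injective
      (LinearMap.ker_eq_bot.2 hv.fintypeLinearCombination_injective)
  choose a ha using fun (j : κ) (i : ι) => residue_surjective (R := R) (P (Pi.single i 1) j)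
  set Vm : Matrix ι κ R := Matrix.of fun i j => v j i with hVm
  set Am : Matrix κ ι R := Matrix.of a with hAm
  have h1 : (residue R).mapMatrix (Am * Vm) = 1 := by
    ext j k
    have := congrFun (LinearMap.congr_fun hP (Pi.single k 1)) j
    rw [LinearMap.comp_apply, Fintype.linearCombination_apply_single, one_smul,
      LinearMap.pi_apply_eq_sum_univ P] at this
    simp only [RingHom.mapMatrix_apply, Matrix.map_apply, Matrix.mul_apply, map_sum, map_mul]
    have e : ∀ i : ι, (fun l => if i = l then (1 : ResidueField R) else 0) = Pi.single i 1 :=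
      fun i => funext fun l => by simp [Pi.single_apply, eq_comm]
    simpa [hAm, hVm, ha, mul_comm, Finset.sum_apply, e, Matrix.one_apply, Pi.single_apply]
      using this
  have h2 : IsUnit (Am * Vm).det := by
    rw [← residue_ne_zero_iff_isUnit, RingHom.map_det, h1, Matrix.det_one]
    exact one_ne_zero
  refine isUnimodularSeq_of_leftInverse (((Am * Vm)⁻¹ * Am).mulVecLin) fun c => ?_
  have h3 : ∑ j, c j • v j = Vm.mulVec c := by
    ext i
    simp [Matrix.mulVec, dotProduct, hVm, mul_comm]
  rw [h3, Matrix.mulVecLin_apply, Matrix.mulVec_mulVec, Matrix.mul_assoc,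
    Matrix.nonsing_inv_mul _ h2, Matrix.one_mulVec]

end Reduction

/-! ## The hyperbolic form -/

section HypVec

variable {R : Type*} {n : ℕ}

/-- The vector with given entries in the first and in the second places of the hyperbolic pairs. -/
def hypVec (a y : Fin n → R) (j : Fin (2 * n)) : R :=
  if (j : ℕ) % 2 = 0 then a ⟨j / 2, by omega⟩ else y ⟨j / 2, by omega⟩

@[simp]
theorem hypVec_hypFst (a y : Fin n → R) (i : Fin n) : hypVec a y (hypFst i) = a i := by
  simp [hypVec, hypFst]

@[simp]
theorem hypVec_hypSnd (a y : Fin n → R) (i : Fin n) : hypVec a y (hypSnd i) = y i := by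
  have h1 : (2 * (i : ℕ) + 1) % 2 ≠ 0 := by omega
  have h2 : (2 * (i : ℕ) + 1) / 2 = i := by omega
  simp [hypVec, hypSnd, h2]

theorem eq_hypFst_or_eq_hypSnd (j : Fin (2 * n)) : ∃ i : Fin n, j = hypFst i ∨ j = hypSnd i := by
  refine ⟨⟨j / 2, by omega⟩, ?_⟩
  simp only [hypFst, hypSnd, Fin.ext_iff]
  omega

end HypVec

section HyperbolicForm

variable {R : Type*} [CommRing R] [StarRing R] {n : ℕ}

theorem hypForm_add_right (ε : R) (x y z : Fin (2 * n) → R) :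
    hypForm ε x (y + z) = hypForm ε x y + hypForm ε x z := by
  simp only [hypForm, Pi.add_apply, ← Finset.sum_add_distrib]
  exact Finset.sum_congr rfl fun i _ => by ring

theorem hypForm_smul_right (ε c : R) (x y : Fin (2 * n) → R) :
    hypForm ε x (c • y) = c * hypForm ε x y := by
  simp only [hypForm, Pi.smul_apply, smul_eq_mul, Finset.mul_sum]
  exact Finset.sum_congr rfl fun i _ => by ring

theorem hypForm_add_left (ε : R) (x y z : Fin (2 * n) → R) :
    hypForm ε (x + y) z = hypForm ε x z + hypForm ε y z := by
  simp only [hypForm, Pi.add_apply, ← Finset.sum_add_distrib, star_add]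
  exact Finset.sum_congr rfl fun i _ => by ring

theorem hypForm_smul_left (ε c : R) (x y : Fin (2 * n) → R) :
    hypForm ε (c • x) y = star c * hypForm ε x y := by
  simp only [hypForm, Pi.smul_apply, smul_eq_mul, Finset.mul_sum, star_mul']
  exact Finset.sum_congr rfl fun i _ => by ring

/-- The hyperbolic form as a linear functional of its second argument. -/
def hypFormLin (ε : R) (x : Fin (2 * n) → R) : (Fin (2 * n) → R) →ₗ[R] R where
  toFun := hypForm ε x
  map_add' := hypForm_add_right ε x
  map_smul' c := hypForm_smul_right ε c x

@[simp]
theorem hypFormLin_apply (ε : R) (x y : Fin (2 * n) → R) : hypFormLin ε x y = hypForm ε x y := rfl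

theorem hypForm_zero_left (ε : R) (y : Fin (2 * n) → R) : hypForm ε 0 y = 0 := by
  simp [hypForm]

theorem hypForm_sum_left (ε : R) {κ : Type*} (s : Finset κ) (v : κ → Fin (2 * n) → R)
    (y : Fin (2 * n) → R) : hypForm ε (∑ j ∈ s, v j) y = ∑ j ∈ s, hypForm ε (v j) y := by
  classical
  induction s using Finset.induction_on with
  | empty => simp [hypForm_zero_left]
  | insert a s ha ih => rw [Finset.sum_insert ha, Finset.sum_insert ha, hypForm_add_left, ih]

theorem hypForm_eq_mul_star {ε : R} (hε : ε * star ε = 1) (x y : Fin (2 * n) → R) :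
    hypForm ε x y = ε * star (hypForm ε y x) := by
  simp only [hypForm, star_sum, Finset.mul_sum, star_add, star_mul', star_star]
  refine Finset.sum_congr rfl fun i _ => ?_
  linear_combination (-(y (hypSnd i) * star (x (hypFst i)))) * hε

theorem hypForm_eq_zero_comm {ε : R} (hε : ε * star ε = 1) {x y : Fin (2 * n) → R}
    (h : hypForm ε y x = 0) : hypForm ε x y = 0 := by
  rw [hypForm_eq_mul_star hε, h, star_zero, mul_zero]

variable {ε : R} (Λ : FormParameter R ε)

theorem hypQuad_eq_zero_iff (x : Fin (2 * n) → R) :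
    hypQuad Λ x = 0 ↔ ∑ i : Fin n, star (x (hypFst i)) * x (hypSnd i) ∈ Λ.toAddSubgroup :=
  QuotientAddGroup.eq_zero_iff _

theorem hypForm_self_of_hypQuad {x : Fin (2 * n) → R} (hx : hypQuad Λ x = 0) :
    hypForm ε x x = 0 := by
  rw [hypQuad_eq_zero_iff] at hx
  have h := Λ.mul_star_eq' _ hx
  have e : hypForm ε x x = ∑ i : Fin n, star (x (hypFst i)) * x (hypSnd i) +
      ε * star (∑ i : Fin n, star (x (hypFst i)) * x (hypSnd i)) := by
    simp only [hypForm, star_sum, Finset.mul_sum, ← Finset.sum_add_distrib, star_mul', star_star]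
    exact Finset.sum_congr rfl fun i _ => by ring
  rw [e, h, add_neg_cancel]

theorem hypQuad_smul {x : Fin (2 * n) → R} (c : R) (hx : hypQuad Λ x = 0) :
    hypQuad Λ (c • x) = 0 := by
  rw [hypQuad_eq_zero_iff] at hx ⊢
  have := Λ.star_mul_mul_mem' c _ hx
  rw [Finset.mul_sum, Finset.sum_mul] at this
  refine (congrArg (· ∈ Λ.toAddSubgroup) (Finset.sum_congr rfl fun i _ => ?_)).mpr this
  simp only [Pi.smul_apply, smul_eq_mul, star_mul']
  ring

/-- The defect of `q(x + y) = q(x) + q(y) + h(x, y)` on representatives has the form `r - ε r̄`,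
which lies in `Λ`. -/
theorem hypQuad_add {x y : Fin (2 * n) → R} (hx : hypQuad Λ x = 0) (hy : hypQuad Λ y = 0)
    (hxy : hypForm ε x y = 0) : hypQuad Λ (x + y) = 0 := by
  rw [hypQuad_eq_zero_iff] at hx hy ⊢
  have h := Λ.sub_mem' (∑ i : Fin n, star (y (hypFst i)) * x (hypSnd i))
  have e : ∑ i : Fin n, star ((x + y) (hypFst i)) * (x + y) (hypSnd i) =
      (∑ i : Fin n, star (x (hypFst i)) * x (hypSnd i)) +
      (∑ i : Fin n, star (y (hypFst i)) * y (hypSnd i)) + hypForm ε x y +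
      ((∑ i : Fin n, star (y (hypFst i)) * x (hypSnd i)) -
        ε * star (∑ i : Fin n, star (y (hypFst i)) * x (hypSnd i))) := by
    simp only [hypForm, star_sum, Finset.mul_sum, ← Finset.sum_add_distrib,
      ← Finset.sum_sub_distrib, star_mul', star_star, star_add, Pi.add_apply]
    exact Finset.sum_congr rfl fun i _ => by ring
  rw [e, hxy, add_zero]
  exact add_mem (add_mem hx hy) h

theorem hypForm_hypVec (x : Fin (2 * n) → R) (a y : Fin n → R) :
    hypForm ε x (hypVec a y) = (∑ i, ε * star (x (hypSnd i)) * a i) +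
      ∑ i, star (x (hypFst i)) * y i := by
  simp only [hypForm, hypVec_hypFst, hypVec_hypSnd, ← Finset.sum_add_distrib]
  exact Finset.sum_congr rfl fun i _ => add_comm _ _

end HyperbolicForm

/-! ## Isotropic vectors in general position -/

section GeneralPosition

open IsLocalRing

theorem exists_residue_ne_zero_of_redMod_ne_zero {R : Type*} [CommRing R] [IsLocalRing R] {n : ℕ}
    {x : Fin (2 * n) → R}
    (hx : redMod R _ x ≠ 0) :
    ∃ i : Fin n, residue R (x (hypFst i)) ≠ 0 ∨ residue R (x (hypSnd i)) ≠ 0 := by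
  obtain ⟨j, hj⟩ := Function.ne_iff.1 hx
  obtain ⟨i, rfl | rfl⟩ := eq_hypFst_or_eq_hypSnd j
  · exact ⟨i, Or.inl hj⟩
  · exact ⟨i, Or.inr hj⟩

theorem exists_forall_residue_add_ne_zero {R : Type*} [CommRing R] [IsLocalRing R]
    [Infinite (ResidueField R)] {κ : Type*} (s : Finset κ) (f g : κ → R)
    (h : ∀ j ∈ s, residue R (f j) ≠ 0 ∨ residue R (g j) ≠ 0) :
    ∃ p t : R, ∀ j ∈ s, residue R (p * f j + t * g j) ≠ 0 := by
  obtain ⟨⟨p, t⟩, hpt⟩ := exists_forall_apply_ne_zero s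
    (fun j => Algebra.linearMap R (ResidueField R) ∘ₗ
      (LinearMap.toSpanSingleton R R (f j)).coprod (LinearMap.toSpanSingleton R R (g j))) (by
    intro j hj
    rcases h j hj with h | h
    · exact ⟨(1, 0), by simpa using h⟩
    · exact ⟨(0, 1), by simpa using h⟩)
  exact ⟨p, t, fun j hj => hpt j hj⟩

variable {R : Type*} [CommRing R] [StarRing R] [IsLocalRing R] {n : ℕ}

theorem residue_star_eq_zero_iff {r : R} : residue R (star r) = 0 ↔ residue R r = 0 := by
  simp only [residue_eq_zero_iff, mem_maximalIdeal, mem_nonunits_iff, not_iff_not]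
  exact ⟨fun h => by simpa using h.star, fun h => h.star⟩

theorem residue_ne_zero_of_mul_star {ε : R} (hε : ε * star ε = 1) : residue R ε ≠ 0 := by
  rw [residue_ne_zero_iff_isUnit]
  exact IsUnit.of_mul_eq_one _ hε

theorem residue_hypForm_eq_zero_comm {ε : R} (hε : ε * star ε = 1) {x y : Fin (2 * n) → R}
    (h : residue R (hypForm ε y x) = 0) : residue R (hypForm ε x y) = 0 := by
  rw [hypForm_eq_mul_star hε, map_mul, residue_star_eq_zero_iff.2 h, mul_zero]

/-- In hyperbolic rank at least `2`, finitely many conditions `h(c, x) ∉ 𝔪`, where `c ∉ 𝔪 R^{2n}`,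
can be satisfied simultaneously by a vector `x` with `q(x) = 0`. -/
theorem exists_hypQuad_eq_zero_forall_hypForm [Infinite (ResidueField R)] {ε : R}
    (hε : ε * star ε = 1) (Λ : FormParameter R ε) (hn : 2 ≤ n) {κ : Type*} (s : Finset κ)
    (c : κ → Fin (2 * n) → R) (hc : ∀ j ∈ s, redMod R _ (c j) ≠ 0) :
    ∃ x : Fin (2 * n) → R, hypQuad Λ x = 0 ∧
      ∀ j ∈ s, residue R (hypForm ε (c j) x) ≠ 0 := by
  classical
  let i₀ : Fin n := ⟨0, by omega⟩
  let i₁ : Fin n := ⟨1, by omega⟩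
  have h01 : i₀ ≠ i₁ := by simp [i₀, i₁, Fin.ext_iff]
  let ρ : R →ₗ[R] ResidueField R := Algebra.linearMap R (ResidueField R)
  have hρ : ∀ r, ρ r = residue R r := fun r => rfl
  let π : Fin n → ((Fin n → R) →ₗ[R] R) := fun i => LinearMap.proj i
  -- The vector sought has first coordinates `p a` and second coordinates `t y` with `∑ ā_i y_i =
  -- 0`, which forces `q = 0`. It can pair nontrivially with `c_j` if `a` pairs nontrivially with
  -- the second coordinates of `c_j`, or if the first coordinates of `c_j` are not proportional to
  -- `a` modulo `𝔪`, as detected by a minor. A single linear condition on `a` ensures one of the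
  -- two.
  have hA : ∀ j, ∃ A : (Fin n → R) →ₗ[R] R, j ∈ s → (∃ z, residue R (A z) ≠ 0) ∧
      ∀ a, residue R (A a) ≠ 0 →
        residue R (∑ i, ε * star (c j (hypSnd i)) * a i) ≠ 0 ∨
        ∃ i, residue R (a i₀ * c j (hypFst i) - a i * c j (hypFst i₀)) ≠ 0 := by
    intro j
    by_cases hj : j ∈ s
    swap
    · exact ⟨0, fun h => absurd h hj⟩
    have key : ∀ i, (∃ z : Fin n → R,
        residue R (z i₀ * c j (hypFst i) - z i * c j (hypFst i₀)) ≠ 0) →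
        ∃ A : (Fin n → R) →ₗ[R] R, j ∈ s → (∃ z, residue R (A z) ≠ 0) ∧
          ∀ a, residue R (A a) ≠ 0 →
          residue R (∑ i, ε * star (c j (hypSnd i)) * a i) ≠ 0 ∨
          ∃ i, residue R (a i₀ * c j (hypFst i) - a i * c j (hypFst i₀)) ≠ 0 := by
      intro i hz
      have e : ∀ z : Fin n → R, (c j (hypFst i) • π i₀ - c j (hypFst i₀) • π i) z =
          z i₀ * c j (hypFst i) - z i * c j (hypFst i₀) := by
        intro z
        simp [π, mul_comm]
      refine ⟨c j (hypFst i) • π i₀ - c j (hypFst i₀) • π i, fun _ => ⟨?_, ?_⟩⟩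
      · simpa only [e] using hz
      · intro a ha
        rw [e] at ha
        exact Or.inr ⟨i, ha⟩
    by_cases h0 : residue R (c j (hypFst i₀)) = 0
    swap
    -- The second hyperbolic pair is needed here: in rank `1` there are no nontrivial minors.
    · refine key i₁ ⟨Pi.single i₁ 1, ?_⟩
      simpa [h01] using h0
    obtain ⟨i, hi | hi⟩ := exists_residue_ne_zero_of_redMod_ne_zero (hc j hj)
    · refine key i ⟨Pi.single i₀ 1, ?_⟩
      simpa [h0] using hi
    · refine ⟨∑ i, (ε * star (c j (hypSnd i))) • π i, fun _ => ⟨⟨Pi.single i 1, ?_⟩, ?_⟩⟩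
      · have : (∑ l, (ε * star (c j (hypSnd l))) • π l) (Pi.single i 1) =
            ε * star (c j (hypSnd i)) := by simp [π, Pi.single_apply]
        rw [this, map_mul]
        exact mul_ne_zero (residue_ne_zero_of_mul_star hε)
          (residue_star_eq_zero_iff.not.2 hi)
      · intro a ha
        exact Or.inl (by simpa [π] using ha)
  choose A hA using hA
  obtain ⟨a, ha⟩ := exists_forall_apply_ne_zero s (fun j => ρ ∘ₗ A j) fun j hj => (hA j hj).1
  have ha' := fun j hj => (hA j hj).2 a (ha j hj)
  -- `Y z = ā_{i₀} z - (∑ ā_l z_l) e_{i₀}` solves `∑ ā_i y_i = 0` for every `z`. With `a` fixed, the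
  -- remaining conditions are linear in `z`, and then in `(p, t)`.
  let Y : (Fin n → R) →ₗ[R] (Fin n → R) :=
    star (a i₀) • LinearMap.id - LinearMap.single R (fun _ => R) i₀ ∘ₗ (∑ l, star (a l) • π l)
  have hY : ∀ z i, Y z i = star (a i₀) * z i - if i = i₀ then ∑ l, star (a l) * z l else 0 := by
    intro z i
    simp [Y, π, Pi.single_apply]
  have hYa : ∀ z, ∑ i, star (a i) * Y z i = 0 := by
    intro z
    simp only [hY, mul_sub, Finset.sum_sub_distrib, mul_ite, mul_zero, Finset.sum_ite_eq',
      Finset.mem_univ, if_true]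
    rw [Finset.mul_sum, sub_eq_zero]
    exact Finset.sum_congr rfl fun i _ => by ring
  let B : κ → (Fin n → R) →ₗ[R] R := fun j => (∑ i, star (c j (hypFst i)) • π i) ∘ₗ Y
  have hB : ∀ j z, B j z = ∑ i, star (c j (hypFst i)) * Y z i := by
    intro j z
    simp [B, π]
  let s' := s.filter fun j => residue R (∑ i, ε * star (c j (hypSnd i)) * a i) = 0
  obtain ⟨z, hz⟩ := exists_forall_apply_ne_zero s' (fun j => ρ ∘ₗ B j) (by
    intro j hj
    obtain ⟨hj, h0⟩ := Finset.mem_filter.1 hj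
    obtain ⟨i, hi⟩ := (ha' j hj).resolve_left (by simpa using h0)
    refine ⟨Pi.single i 1, ?_⟩
    rw [LinearMap.comp_apply, hρ, hB]
    rw [Ne, ← residue_star_eq_zero_iff] at hi
    convert hi using 2
    simp only [hY, mul_sub, Finset.sum_sub_distrib, mul_ite, mul_zero, Finset.sum_ite_eq',
      Finset.mem_univ, if_true, Pi.single_apply, star_sub, star_mul', mul_one]
    ring)
  obtain ⟨p, t, hpt⟩ := exists_forall_residue_add_ne_zero s
    (fun j => ∑ i, ε * star (c j (hypSnd i)) * a i) (fun j => B j z) (by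
    intro j hj
    by_cases h0 : residue R (∑ i, ε * star (c j (hypSnd i)) * a i) = 0
    · exact Or.inr (hz j (Finset.mem_filter.2 ⟨hj, h0⟩))
    · exact Or.inl h0)
  refine ⟨hypVec (p • a) (t • Y z), ?_, fun j hj => ?_⟩
  · rw [hypQuad_eq_zero_iff]
    have : ∑ i, star (hypVec (p • a) (t • Y z) (hypFst i)) * hypVec (p • a) (t • Y z) (hypSnd i) =
        star p * t * ∑ i, star (a i) * Y z i := by
      rw [Finset.mul_sum]
      exact Finset.sum_congr rfl fun i _ => by
        simp only [hypVec_hypFst, hypVec_hypSnd, Pi.smul_apply, smul_eq_mul, star_mul']; ring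
    rw [this, hYa, mul_zero]
    exact zero_mem _
  · convert hpt j hj using 1
    rw [hypForm_hypVec, hB, Finset.mul_sum, Finset.mul_sum]
    congr 2 <;> exact Finset.sum_congr rfl fun i _ => by
      simp only [Pi.smul_apply, smul_eq_mul]; ring

end GeneralPosition

/-! ## Reduced spans -/

section ReducedSpan

open IsLocalRing Module

variable {R : Type*} [CommRing R] [IsLocalRing R] {n : ℕ}

theorem dual_ext_redMod {f g : Dual (ResidueField R) (Fin (2 * n) → ResidueField R)}
    (h : ∀ y, f (redMod R _ y) = g (redMod R _ y)) : f = g := by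
  refine LinearMap.ext fun y => ?_
  obtain ⟨y, rfl⟩ := redMod_surjective _ y
  exact h y

/-- The reduced span of the entries of a list. -/
noncomputable def redSpan (l : List (Fin (2 * n) → R)) :
    Submodule (ResidueField R) (Fin (2 * n) → ResidueField R) :=
  Submodule.span _ (redMod R _ '' {x | x ∈ l})

theorem redMod_mem_redSpan {l : List (Fin (2 * n) → R)} {x : Fin (2 * n) → R} (hx : x ∈ l) :
    redMod R _ x ∈ redSpan l :=
  Submodule.subset_span ⟨x, hx, rfl⟩

theorem redSpan_le {l : List (Fin (2 * n) → R)}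
    {W : Submodule (ResidueField R) (Fin (2 * n) → ResidueField R)}
    (h : ∀ x ∈ l, redMod R _ x ∈ W) : redSpan l ≤ W := by
  refine Submodule.span_le.2 ?_
  rintro _ ⟨x, hx, rfl⟩
  exact h x hx

theorem redSpan_mono {l l' : List (Fin (2 * n) → R)} (h : ∀ x ∈ l, x ∈ l') :
    redSpan l ≤ redSpan l' :=
  redSpan_le fun x hx => redMod_mem_redSpan (h x hx)

theorem redSpan_append (l l' : List (Fin (2 * n) → R)) :
    redSpan (l ++ l') ≤ redSpan l ⊔ redSpan l' := by
  refine redSpan_le fun x hx => ?_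
  rcases List.mem_append.1 hx with h | h
  · exact Submodule.mem_sup_left (redMod_mem_redSpan h)
  · exact Submodule.mem_sup_right (redMod_mem_redSpan h)

theorem finrank_redSpan_le (l : List (Fin (2 * n) → R)) :
    finrank (ResidueField R) (redSpan l) ≤ l.length := by
  classical
  have e : (redMod R _ '' {x | x ∈ l}) = ((l.map (redMod R _)).toFinset : Set _) := by
    ext; simp
  rw [redSpan, e]
  refine (finrank_span_finset_le_card _).trans ((List.toFinset_card_le _).trans ?_)
  simp

/-- The reduction of a submodule. -/
noncomputable abbrev redSub (L : Submodule R (Fin (2 * n) → R)) :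
    Submodule (ResidueField R) (Fin (2 * n) → ResidueField R) :=
  L.map (redMod R _)

theorem exists_linearIndependent_redMod (L : Submodule R (Fin (2 * n) → R)) :
    ∃ y : Fin (finrank (ResidueField R) (redSub L)) → Fin (2 * n) → R, (∀ i, y i ∈ L) ∧
      LinearIndependent (ResidueField R) fun i => redMod R _ (y i) := by
  have h := (Module.finBasis (ResidueField R) (redSub L)).linearIndependent.map'
    (redSub L).subtype (Submodule.ker_subtype _)
  have hb : ∀ i, ∃ y ∈ L,
      redMod R _ y = (redSub L).subtype (Module.finBasis (ResidueField R) (redSub L) i) :=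
    fun i => (Module.finBasis (ResidueField R) (redSub L) i).2
  choose y hyL hy using hb
  refine ⟨y, hyL, ?_⟩
  have e : (fun i => redMod R _ (y i)) =
      (redSub L).subtype ∘ Module.finBasis (ResidueField R) (redSub L) := funext hy
  rw [e]
  exact h

end ReducedSpan

/-! ## The reduced form -/

section ReducedForm

open IsLocalRing Module

variable {R : Type*} [CommRing R] [StarRing R] [IsLocalRing R] {n : ℕ}

/-- The reduction of the functional `h(x, -)` modulo the maximal ideal. -/
noncomputable def hypDual (ε : R) (x : Fin (2 * n) → R) :
    Dual (ResidueField R) (Fin (2 * n) → ResidueField R) :=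
  ∑ i : Fin n, (residue R (star (x (hypFst i))) • LinearMap.proj (hypSnd i) +
    residue R (ε * star (x (hypSnd i))) • LinearMap.proj (hypFst i))

@[simp]
theorem hypDual_redMod (ε : R) (x y : Fin (2 * n) → R) :
    hypDual ε x (redMod R _ y) = residue R (hypForm ε x y) := by
  simp [hypDual, hypForm, LinearMap.sum_apply]

theorem redMod_eq_zero_of_hypDual_eq_zero {ε : R} (hε : ε * star ε = 1) {x : Fin (2 * n) → R}
    (h : hypDual ε x = 0) : redMod R _ x = 0 := by
  classical
  by_contra hx
  obtain ⟨i, hi | hi⟩ := exists_residue_ne_zero_of_redMod_ne_zero hx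
  · have := LinearMap.congr_fun h (redMod R _ (hypVec 0 (Pi.single i 1)))
    rw [hypDual_redMod, hypForm_hypVec] at this
    simp only [Pi.single_apply, Pi.zero_apply, mul_zero, Finset.sum_const_zero, zero_add,
      mul_ite, mul_one, Finset.sum_ite_eq', Finset.mem_univ, if_true, LinearMap.zero_apply] at this
    exact hi (residue_star_eq_zero_iff.1 this)
  · have := LinearMap.congr_fun h (redMod R _ (hypVec (Pi.single i 1) 0))
    rw [hypDual_redMod, hypForm_hypVec] at this
    simp only [Pi.single_apply, Pi.zero_apply, mul_zero, Finset.sum_const_zero, add_zero,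
      mul_ite, mul_one, Finset.sum_ite_eq', Finset.mem_univ, if_true, LinearMap.zero_apply,
      map_mul] at this
    exact hi (residue_star_eq_zero_iff.1
      ((mul_eq_zero.1 this).resolve_left (residue_ne_zero_of_mul_star hε)))

/-- Conjugating the coefficients compensates for the conjugate-linearity of `h` on the left, so no
involution on the residue field is needed. -/
theorem hypDual_sum_star_smul (ε : R) {κ : Type*} [Fintype κ] (c : κ → R)
    (v : κ → Fin (2 * n) → R) :
    hypDual ε (∑ j, star (c j) • v j) = ∑ j, residue R (c j) • hypDual ε (v j) := by
  refine dual_ext_redMod fun y => ?_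
  rw [hypDual_redMod, hypForm_sum_left, map_sum, LinearMap.sum_apply]
  exact Finset.sum_congr rfl fun j _ => by
    rw [hypForm_smul_left, star_star, map_mul, LinearMap.smul_apply, hypDual_redMod, smul_eq_mul]

theorem residue_eq_zero_of_redMod_sum_star {κ : Type*} [Fintype κ] {c : κ → R}
    {v : κ → Fin (2 * n) → R} (hv : LinearIndependent (ResidueField R) fun j => redMod R _ (v j))
    (h : redMod R _ (∑ j, star (c j) • v j) = 0) (j : κ) : residue R (c j) = 0 := by
  rw [map_sum] at h
  simp only [LinearMap.map_smulₛₗ] at h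
  exact residue_star_eq_zero_iff.1 (Fintype.linearIndependent_iff.1 hv _ h j)

theorem linearIndependent_hypDual {ε : R} (hε : ε * star ε = 1) {κ : Type*} [Fintype κ]
    {v : κ → Fin (2 * n) → R} (hv : LinearIndependent (ResidueField R) fun j => redMod R _ (v j)) :
    LinearIndependent (ResidueField R) fun j => hypDual ε (v j) := by
  rw [Fintype.linearIndependent_iff]
  intro g hg j
  choose c hc using fun j => residue_surjective (g j)
  obtain rfl : (fun j => residue R (c j)) = g := funext hc
  rw [← hypDual_sum_star_smul] at hg
  exact residue_eq_zero_of_redMod_sum_star hv (redMod_eq_zero_of_hypDual_eq_zero hε hg) j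

/-- The vectors over the residue field that are orthogonal to the entries of a list. -/
noncomputable def redPerp (ε : R) (l : List (Fin (2 * n) → R)) :
    Submodule (ResidueField R) (Fin (2 * n) → ResidueField R) :=
  ⨅ x ∈ l, LinearMap.ker (hypDual ε x)

theorem mem_redPerp {ε : R} {l : List (Fin (2 * n) → R)} {y : Fin (2 * n) → ResidueField R} :
    y ∈ redPerp ε l ↔ ∀ x ∈ l, hypDual ε x y = 0 := by
  simp [redPerp, Submodule.mem_iInf]

theorem finrank_le_finrank_inf_ker {K V : Type*} [Field K] [AddCommGroup V] [Module K V]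
    [FiniteDimensional K V] (W : Submodule K V) (f : Dual K V) :
    finrank K W ≤ finrank K ↥(W ⊓ LinearMap.ker f) + 1 := by
  have h := LinearMap.finrank_range_add_finrank_ker (f ∘ₗ W.subtype)
  have h1 : finrank K (LinearMap.range (f ∘ₗ W.subtype)) ≤ 1 :=
    (Submodule.finrank_le _).trans (finrank_self K).le
  have h2 : finrank K (LinearMap.ker (f ∘ₗ W.subtype)) = finrank K ↥(W ⊓ LinearMap.ker f) := by
    rw [LinearMap.ker_comp, ← Submodule.map_comap_subtype]
    exact (LinearEquiv.finrank_eq (Submodule.equivMapOfInjective _ W.injective_subtype _))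
  omega

theorem finrank_le_finrank_inf_redPerp (ε : R)
    (W : Submodule (ResidueField R) (Fin (2 * n) → ResidueField R))
    (l : List (Fin (2 * n) → R)) :
    finrank (ResidueField R) W ≤ finrank (ResidueField R) ↥(W ⊓ redPerp ε l) + l.length := by
  induction l with
  | nil => exact (Submodule.finrank_mono (by simp [redPerp])).trans (Nat.le_add_right _ _)
  | cons x l ih =>
    have h := finrank_le_finrank_inf_ker (W ⊓ redPerp ε l) (hypDual ε x)
    have e : W ⊓ redPerp ε l ⊓ LinearMap.ker (hypDual ε x) = W ⊓ redPerp ε (x :: l) := by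
      ext y
      simp only [mem_redPerp, Submodule.mem_inf, LinearMap.mem_ker, List.forall_mem_cons]
      tauto
    rw [e] at h
    rw [List.length_cons]
    omega

end ReducedForm

/-! ## Lagrangian submodules -/

section Adjacent

variable {R : Type*} [CommRing R] [StarRing R] {n : ℕ} {ε : R}
  {L : Submodule R (Fin (2 * n) → R)}

/-- The submodule obtained from `L` by passing to the adjacent one that contains `x`. -/
def adjacentSubmodule (ε : R) (L : Submodule R (Fin (2 * n) → R)) (x : Fin (2 * n) → R) :
    Submodule R (Fin (2 * n) → R) :=
  L ⊓ LinearMap.ker (hypFormLin ε x) ⊔ Submodule.span R {x}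

theorem mem_adjacentSubmodule {x z : Fin (2 * n) → R} :
    z ∈ adjacentSubmodule ε L x ↔ ∃ y ∈ L, hypForm ε x y = 0 ∧ ∃ c : R, z = y + c • x := by
  simp only [adjacentSubmodule, Submodule.mem_sup, Submodule.mem_inf, LinearMap.mem_ker,
    hypFormLin_apply, Submodule.mem_span_singleton]
  constructor
  · rintro ⟨y, ⟨hy, hxy⟩, _, ⟨c, rfl⟩, rfl⟩
    exact ⟨y, hy, hxy, c, rfl⟩
  · rintro ⟨y, hy, hxy, c, rfl⟩
    exact ⟨y, ⟨hy, hxy⟩, _, ⟨c, rfl⟩, rfl⟩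

end Adjacent

section Lagrangian

open IsLocalRing Module

variable {R : Type*} [CommRing R] [StarRing R] [IsLocalRing R] {n : ℕ} {ε : R}

/-- A totally isotropic submodule whose reduction has dimension at least `n`. -/
structure IsLagrangian (Λ : FormParameter R ε) (L : Submodule R (Fin (2 * n) → R)) : Prop where
  quad : ∀ x ∈ L, hypQuad Λ x = 0
  form : ∀ x ∈ L, ∀ y ∈ L, hypForm ε x y = 0
  le_finrank : n ≤ finrank (ResidueField R) (redSub L)

variable {Λ : FormParameter R ε} {L : Submodule R (Fin (2 * n) → R)}

theorem exists_isLagrangian (Λ : FormParameter R ε) (n : ℕ) :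
    ∃ L : Submodule R (Fin (2 * n) → R), IsLagrangian Λ L := by
  classical
  refine ⟨⨅ i : Fin n, LinearMap.ker (LinearMap.proj (hypSnd i)), ?_, ?_, ?_⟩
  · intro x hx
    simp only [Submodule.mem_iInf, LinearMap.mem_ker, LinearMap.proj_apply] at hx
    simp [hypQuad, hx]
  · intro x hx y hy
    simp only [Submodule.mem_iInf, LinearMap.mem_ker, LinearMap.proj_apply] at hx hy
    simp [hypForm, hx, hy]
  · set W := redSub (R := R) (⨅ i : Fin n, LinearMap.ker (LinearMap.proj (hypSnd i)))
    let e : Fin n → W := fun i => ⟨redMod R _ (hypVec (Pi.single i 1) 0), _, by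
      simp, rfl⟩
    have : LinearIndependent (ResidueField R) e := by
      refine LinearIndependent.of_comp W.subtype (Fintype.linearIndependent_iff.2 fun g hg i => ?_)
      have := congrFun hg (hypFst i)
      simpa [e, Finset.sum_apply, Pi.single_apply, apply_ite (residue R)] using this
    simpa using this.fintype_card_le_finrank

/-- Modulo `𝔪` a Lagrangian is its own orthogonal complement: by nondegeneracy the complement has
dimension `2n - dim ≤ n ≤ dim`, and it contains the Lagrangian. -/
theorem IsLagrangian.redMod_mem (hL : IsLagrangian Λ L) (hε : ε * star ε = 1)
    {s : Fin (2 * n) → R} (hs : ∀ y ∈ L, residue R (hypForm ε s y) = 0) :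
    redMod R _ s ∈ redSub L := by
  obtain ⟨y, hyL, hli⟩ := exists_linearIndependent_redMod L
  have h1 := finrank_span_eq_card (linearIndependent_hypDual hε hli)
  rw [Fintype.card_fin] at h1
  set Φ := Submodule.span (ResidueField R) (Set.range fun i => hypDual ε (y i)) with hΦ
  have h2 := Subspace.finrank_add_finrank_dualCoannihilator_eq Φ
  rw [h1, finrank_fin_fun] at h2
  have h3 := hL.le_finrank
  have hmem : ∀ z, (∀ i, hypDual ε (y i) z = 0) → z ∈ Φ.dualCoannihilator := by
    intro z hz
    rw [Submodule.mem_dualCoannihilator]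
    have : Φ ≤ LinearMap.ker (Dual.eval (ResidueField R) _ z) := by
      rw [hΦ, Submodule.span_le]
      rintro _ ⟨i, rfl⟩
      exact hz i
    exact fun φ hφ => this hφ
  have h4 : redSub L ≤ Φ.dualCoannihilator := by
    rintro _ ⟨z, hz, rfl⟩
    refine hmem _ fun i => ?_
    rw [hypDual_redMod, hL.form _ (hyL i) _ hz, map_zero]
  have h5 := Submodule.eq_of_le_of_finrank_le h4 (by omega)
  rw [h5]
  refine hmem _ fun i => ?_
  rw [hypDual_redMod]
  exact residue_hypForm_eq_zero_comm hε (hs _ (hyL i))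

/-- Passing to `M = L ∩ x^⊥` loses at most one dimension, because `L = M + R u`. Adding `x` gains it
back, because `u` is orthogonal to `M` but not to `x` modulo `𝔪`. -/
theorem IsLagrangian.adjacent (hL : IsLagrangian Λ L) (hε : ε * star ε = 1)
    {x u : Fin (2 * n) → R} (hx : hypQuad Λ x = 0) (hu : u ∈ L)
    (hux : residue R (hypForm ε u x) ≠ 0) : IsLagrangian Λ (adjacentSubmodule ε L x) where
  quad := by
    intro z hz
    obtain ⟨y, hy, hxy, c, rfl⟩ := mem_adjacentSubmodule.1 hz
    refine hypQuad_add Λ (hL.quad y hy) (hypQuad_smul Λ c hx) ?_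
    rw [hypForm_smul_right, hypForm_eq_zero_comm hε hxy, mul_zero]
  form := by
    intro z hz z' hz'
    obtain ⟨y, hy, hxy, c, rfl⟩ := mem_adjacentSubmodule.1 hz
    obtain ⟨y', hy', hxy', c', rfl⟩ := mem_adjacentSubmodule.1 hz'
    simp only [hypForm_add_left, hypForm_add_right, hypForm_smul_left, hypForm_smul_right,
      hL.form y hy y' hy', hxy', hypForm_eq_zero_comm hε hxy, hypForm_self_of_hypQuad Λ hx]
    ring
  le_finrank := by
    have hxu : residue R (hypForm ε x u) ≠ 0 := fun h =>
      hux (residue_hypForm_eq_zero_comm hε h)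
    obtain ⟨r, hr⟩ := ((residue_ne_zero_iff_isUnit _).1 hxu).exists_right_inv
    set M := L ⊓ LinearMap.ker (hypFormLin ε x) with hM
    have hxM : redMod R _ x ∉ redSub M := by
      rintro ⟨y, hy, hyx⟩
      apply hux
      rw [← hypDual_redMod, ← hyx, hypDual_redMod, hL.form u hu y hy.1, map_zero]
    have h1 : redSub L ≤ redSub M ⊔ Submodule.span _ {redMod R _ u} := by
      rintro _ ⟨y, hy, rfl⟩
      have e : y = (y - (hypForm ε x y * r) • u) + (hypForm ε x y * r) • u := by abel
      rw [e, map_add]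
      refine Submodule.add_mem_sup ⟨_, ⟨L.sub_mem hy (L.smul_mem _ hu), ?_⟩, rfl⟩ ?_
      · rw [SetLike.mem_coe, LinearMap.mem_ker, map_sub, map_smul, hypFormLin_apply,
          hypFormLin_apply, smul_eq_mul]
        linear_combination (-hypForm ε x y) * hr
      · rw [LinearMap.map_smulₛₗ]
        exact Submodule.smul_mem _ _ (Submodule.mem_span_singleton_self _)
    have h2 : redSub M ⊔ Submodule.span _ {redMod R _ x} ≤ redSub (adjacentSubmodule ε L x) := by
      refine sup_le (Submodule.map_mono le_sup_left) ?_
      rw [Submodule.span_singleton_le_iff_mem]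
      exact ⟨x, Submodule.mem_sup_right (Submodule.mem_span_singleton_self _), rfl⟩
    have h3 := Submodule.finrank_mono h2
    rw [Submodule.finrank_sup_span_singleton hxM] at h3
    have h4 := (Submodule.finrank_mono h1).trans
      (Submodule.finrank_add_le_finrank_add_finrank _ _)
    have h5 : finrank (ResidueField R) (Submodule.span (ResidueField R) {redMod R _ u}) ≤ 1 :=
      (finrank_span_le_card _).trans (by simp)
    have := hL.le_finrank
    omega

theorem IsLagrangian.exists_redMod_ne_zero (hL : IsLagrangian Λ L) {v : List (Fin (2 * n) → R)}
    (hv : v.length < n) :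
    ∃ a ∈ L, redMod R _ a ≠ 0 ∧ ∀ x ∈ v, residue R (hypForm ε x a) = 0 := by
  have h := finrank_le_finrank_inf_redPerp ε (redSub L) v
  have h' := hL.le_finrank
  have : redSub L ⊓ redPerp ε v ≠ ⊥ := by
    intro h0
    rw [h0, finrank_bot] at h
    omega
  obtain ⟨_, ⟨⟨a, ha, rfl⟩, hp⟩, h0⟩ := Submodule.exists_mem_ne_zero_of_ne_bot this
  refine ⟨a, ha, h0, fun x hx => ?_⟩
  rw [← hypDual_redMod]
  exact mem_redPerp.1 hp x hx

/-- Finitely many spans of fewer than `n` vectors are made less incident to a Lagrangian. -/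
theorem IsLagrangian.exists_finrank_inf_le [Infinite (ResidueField R)] (hL : IsLagrangian Λ L)
    (hε : ε * star ε = 1) (hn : 2 ≤ n) (F : Finset (List (Fin (2 * n) → R)))
    (hF : ∀ v ∈ F, v.length < n) (d : ℕ)
    (hd : ∀ v ∈ F, finrank (ResidueField R) ↥(redSpan v ⊓ redSub L) ≤ d + 1) :
    ∃ L' : Submodule R (Fin (2 * n) → R), IsLagrangian Λ L' ∧
      ∀ v ∈ F, finrank (ResidueField R) ↥(redSpan v ⊓ redSub L') ≤ d := by
  classical
  rcases F.eq_empty_or_nonempty with rfl | ⟨v₀, hv₀⟩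
  · exact ⟨L, hL, by simp⟩
  -- The vector `a v` keeps the intersection with `redSpan v` from growing, and `b v` is a vector to
  -- be expelled from it. If the intersection is already zero, `b v` is just some vector with
  -- nonzero reduction.
  have ha : ∀ v, ∃ a, v ∈ F → a ∈ L ∧ redMod R _ a ≠ 0 ∧
      ∀ x ∈ v, residue R (hypForm ε x a) = 0 := by
    intro v
    by_cases hv : v ∈ F
    · obtain ⟨a, h⟩ := hL.exists_redMod_ne_zero (hF v hv)
      exact ⟨a, fun _ => h⟩
    · exact ⟨0, fun h => absurd h hv⟩
  choose a ha using ha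
  have hb : ∀ v, ∃ b, v ∈ F → redMod R _ b ≠ 0 ∧
      (redSpan v ⊓ redSub L ≠ ⊥ → redMod R _ b ∈ redSpan v ⊓ redSub L) := by
    intro v
    by_cases h : redSpan v ⊓ redSub L = ⊥
    · exact ⟨a v, fun hv => ⟨(ha v hv).2.1, fun h' => absurd h h'⟩⟩
    · obtain ⟨b, hb, h0⟩ := Submodule.exists_mem_ne_zero_of_ne_bot h
      obtain ⟨b, rfl⟩ := redMod_surjective _ b
      exact ⟨b, fun _ => ⟨h0, fun _ => hb⟩⟩
  choose b hb using hb
  obtain ⟨x, hx, hxab⟩ := exists_hypQuad_eq_zero_forall_hypForm hε Λ hn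
    (F.disjSum F) (Sum.elim a b) (by
      intro j hj
      rcases j with v | v
      · exact (ha v (by simpa using hj)).2.1
      · exact (hb v (by simpa using hj)).1)
  have hxa : ∀ v ∈ F, residue R (hypForm ε (a v) x) ≠ 0 := fun v hv =>
    hxab (Sum.inl v) (by simpa using hv)
  have hxb : ∀ v ∈ F, residue R (hypForm ε (b v) x) ≠ 0 := fun v hv =>
    hxab (Sum.inr v) (by simpa using hv)
  have hL' := hL.adjacent hε hx (ha v₀ hv₀).1 (hxa v₀ hv₀)
  refine ⟨_, hL', fun v hv => ?_⟩
  obtain ⟨haL, -, hav⟩ := ha v hv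
  -- Pairing with `a v` kills `redSpan v` and `L` but not `x`, so the coefficient of `x` lies in
  -- `𝔪`.
  have hle : redSpan v ⊓ redSub (adjacentSubmodule ε L x) ≤ redSpan v ⊓ redSub L := by
    rintro _ ⟨hz, z, hzL, rfl⟩
    refine ⟨hz, ?_⟩
    obtain ⟨y, hy, -, c, rfl⟩ := mem_adjacentSubmodule.1 hzL
    have h1 : redSpan v ≤ LinearMap.ker (hypDual ε (a v)) := redSpan_le fun w hw => by
      rw [LinearMap.mem_ker, hypDual_redMod]
      exact residue_hypForm_eq_zero_comm hε (hav w hw)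
    have h2 := LinearMap.mem_ker.1 (h1 hz)
    rw [hypDual_redMod, hypForm_add_right, hL.form _ haL _ hy, zero_add, hypForm_smul_right,
      map_mul] at h2
    have h3 := (mul_eq_zero.1 h2).resolve_right (hxa v hv)
    rw [map_add, LinearMap.map_smulₛₗ, h3, zero_smul, add_zero]
    exact ⟨y, hy, rfl⟩
  by_cases h : redSpan v ⊓ redSub L = ⊥
  · rw [h, le_bot_iff] at hle
    rw [hle, finrank_bot]
    exact Nat.zero_le _
  -- The new Lagrangian contains `x` and is isotropic, whereas `h(x, b v)` is a unit; so `b v` has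
  -- left the intersection.
  · have hlt : redSpan v ⊓ redSub (adjacentSubmodule ε L x) < redSpan v ⊓ redSub L := by
      refine lt_of_le_of_ne hle fun he => ?_
      have hbm := (hb v hv).2 h
      rw [← he] at hbm
      obtain ⟨z, hzL, hz⟩ := hbm.2
      have hxz : hypForm ε x z = 0 := hL'.form _
        (Submodule.mem_sup_right (Submodule.mem_span_singleton_self _)) _ hzL
      apply hxb v hv
      apply residue_hypForm_eq_zero_comm hε
      rw [← hypDual_redMod, ← hz, hypDual_redMod, hxz, map_zero]
    have := Submodule.finrank_lt_finrank_of_lt hlt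
    have := hd v hv
    omega

/-- There is a Lagrangian that is transverse to finitely many spans of fewer than `n` vectors. -/
theorem exists_isLagrangian_forall_inf_eq_bot [Infinite (ResidueField R)] (Λ : FormParameter R ε)
    (hε : ε * star ε = 1) (hn : 2 ≤ n) (F : Finset (List (Fin (2 * n) → R)))
    (hF : ∀ v ∈ F, v.length < n) :
    ∃ L : Submodule R (Fin (2 * n) → R), IsLagrangian Λ L ∧
      ∀ v ∈ F, redSpan v ⊓ redSub L = ⊥ := by
  suffices H : ∀ t ≤ n, ∃ L : Submodule R (Fin (2 * n) → R), IsLagrangian Λ L ∧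
      ∀ v ∈ F, finrank (ResidueField R) ↥(redSpan v ⊓ redSub L) ≤ n - t by
    obtain ⟨L, hL, h⟩ := H n le_rfl
    refine ⟨L, hL, fun v hv => Submodule.finrank_eq_zero.1 ?_⟩
    simpa using h v hv
  intro t
  induction t with
  | zero =>
    intro _
    obtain ⟨L, hL⟩ := exists_isLagrangian Λ n
    exact ⟨L, hL, fun v hv => (Submodule.finrank_mono inf_le_left).trans
      ((finrank_redSpan_le v).trans (hF v hv).le)⟩
  | succ t ih =>
    intro ht
    obtain ⟨L, hL, h⟩ := ih (by omega)
    exact hL.exists_finrank_inf_le hε hn F hF (n - (t + 1)) fun v hv =>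
      (h v hv).trans (by omega)

end Lagrangian

/-! ## Frames as lists -/

section ListFrames

open IsLocalRing Module

variable {R : Type*} [CommRing R] [IsLocalRing R] {n : ℕ}

/-- The entries of the list are linearly independent modulo the maximal ideal. -/
def RedIndep : List (Fin (2 * n) → R) → Prop
  | [] => True
  | w :: l => redMod R _ w ∉ redSpan l ∧ RedIndep l

theorem RedIndep.sublist {l l' : List (Fin (2 * n) → R)} (hs : l'.Sublist l) (hl : RedIndep l) :
    RedIndep l' := by
  induction hs with
  | slnil => trivial
  | cons a _ ih => exact ih hl.2
  | cons_cons a hs ih => exact ⟨fun h => hl.1 (redSpan_mono (fun x hx => hs.subset hx) h), ih hl.2⟩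

theorem RedIndep.redMod_ne_zero {l : List (Fin (2 * n) → R)} (hl : RedIndep l)
    {x : Fin (2 * n) → R} (hx : x ∈ l) : redMod R _ x ≠ 0 := by
  intro h
  have := (hl.sublist (List.singleton_sublist.2 hx)).1
  rw [h] at this
  exact this (zero_mem _)

theorem redSpan_ofFn {k : ℕ} (v : Fin k → Fin (2 * n) → R) :
    redSpan (List.ofFn v) = Submodule.span _ (Set.range fun i => redMod R _ (v i)) := by
  rw [redSpan]
  congr 1
  ext y
  simp [List.mem_ofFn]

theorem redIndep_ofFn {k : ℕ} (v : Fin k → Fin (2 * n) → R) :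
    RedIndep (List.ofFn v) ↔ LinearIndependent (ResidueField R) fun i => redMod R _ (v i) := by
  induction k with
  | zero => simp [RedIndep]
  | succ k ih =>
    rw [List.ofFn_succ, RedIndep, ih, redSpan_ofFn, linearIndependent_finSucc, and_comm]
    rfl

end ListFrames

/-! ### Coning off frames with vectors of a Lagrangian -/

section Cones

open IsLocalRing Module

variable {R : Type*} [CommRing R] [StarRing R] [IsLocalRing R] {n : ℕ} {ε : R}
  {Λ : FormParameter R ε} {L : Submodule R (Fin (2 * n) → R)}

/-- The list is an isotropic unimodular frame. -/
structure IsFrameList (Λ : FormParameter R ε) (l : List (Fin (2 * n) → R)) : Prop where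
  indep : RedIndep l
  quad : ∀ x ∈ l, hypQuad Λ x = 0
  form : ∀ x ∈ l, ∀ y ∈ l, hypForm ε x y = 0

theorem IsFrameList.sublist {l l' : List (Fin (2 * n) → R)} (hl : IsFrameList Λ l)
    (hs : l'.Sublist l) : IsFrameList Λ l' :=
  ⟨hl.indep.sublist hs, fun x hx => hl.quad x (hs.subset hx),
    fun x hx y hy => hl.form x (hs.subset hx) y (hs.subset hy)⟩

theorem isFrameList_ofFn {k : ℕ} (v : Fin (k + 1) ↪ (Fin (2 * n) → R)) :
    IsFrameList Λ (List.ofFn v) ↔ OrdSeq.mk k v ∈ isotropicUnimodularPoset Λ n := by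
  constructor
  · intro h
    exact ⟨isUnimodularSeq_of_linearIndependent_redMod ((redIndep_ofFn v).1 h.indep),
      fun i => h.quad _ (List.mem_ofFn.2 ⟨i, rfl⟩),
      fun i j => h.form _ (List.mem_ofFn.2 ⟨i, rfl⟩) _ (List.mem_ofFn.2 ⟨j, rfl⟩)⟩
  · rintro ⟨hu, hq, hh⟩
    refine ⟨(redIndep_ofFn v).2 hu.linearIndependent_redMod, fun x hx => ?_, fun x hx y hy => ?_⟩
    · obtain ⟨i, rfl⟩ := List.mem_ofFn.1 hx
      exact hq i
    · obtain ⟨i, rfl⟩ := List.mem_ofFn.1 hx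
      obtain ⟨j, rfl⟩ := List.mem_ofFn.1 hy
      exact hh i j

theorem mem_range_toList_of_isFrameList {k : ℕ} {l : List (Fin (2 * n) → R)}
    (hl : IsFrameList Λ l) (hk : l.length = k + 1) :
    l ∈ Set.range (FrameSimplex.toList :
      FrameSimplex (isotropicUnimodularPoset Λ n) k → List (Fin (2 * n) → R)) := by
  obtain ⟨v, rfl⟩ : ∃ v : Fin (k + 1) → Fin (2 * n) → R, l = List.ofFn v :=
    ⟨fun i => l.get (i.cast hk.symm), List.ext_getElem (by simp [hk]) fun i h₁ h₂ => by
      rw [List.getElem_ofFn]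
      rfl⟩
  have hv := ((redIndep_ofFn v).1 hl.indep).injective
  let v' : Fin (k + 1) ↪ (Fin (2 * n) → R) := ⟨v, fun i j h => hv (congrArg (redMod R _) h)⟩
  exact ⟨⟨v', (isFrameList_ofFn v').1 hl⟩, rfl⟩

/-- Pairing with a frame that is transverse to a Lagrangian is surjective. -/
theorem IsLagrangian.exists_hypForm_eq (hL : IsLagrangian Λ L) (hε : ε * star ε = 1) {k : ℕ}
    {v : Fin k → Fin (2 * n) → R} (hv : LinearIndependent (ResidueField R) fun i => redMod R _ (v i))
    (hd : redSpan (List.ofFn v) ⊓ redSub L = ⊥) (b : Fin k → R) :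
    ∃ y ∈ L, ∀ j, hypForm ε (v j) y = b j := by
  classical
  let Ψ : (Fin (2 * n) → R) →ₗ[R] (Fin k → R) := LinearMap.pi fun j => hypFormLin ε (v j)
  have hΨ : ∀ y j, Ψ y j = hypForm ε (v j) y := fun _ _ => rfl
  -- A functional killing the image gives a combination of the `v j` orthogonal to `L` modulo `𝔪`.
  -- Its reduction lies in that of `L` by maximality, hence is zero by transversality.
  have h1 : (L.map Ψ).map (redMod R (Fin k)) = ⊤ := by
    by_contra hne
    obtain ⟨f, hf0, hf⟩ := Submodule.exists_le_ker_of_lt_top _ (lt_top_iff_ne_top.2 hne)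
    choose c hc using fun j => residue_surjective (R := R) (f (Pi.single j 1))
    have hs : ∀ y ∈ L, residue R (hypForm ε (∑ j, star (c j) • v j) y) = 0 := by
      intro y hy
      have h := hf ⟨_, ⟨y, hy, rfl⟩, rfl⟩
      rw [LinearMap.mem_ker, LinearMap.pi_apply_eq_sum_univ f] at h
      have e : ∀ i : Fin k, (fun l => if i = l then (1 : ResidueField R) else 0) =
          Pi.single i 1 := fun i => funext fun l => by simp [Pi.single_apply, eq_comm]
      rw [hypForm_sum_left, map_sum, ← h]
      refine Finset.sum_congr rfl fun j _ => ?_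
      rw [hypForm_smul_left, star_star, map_mul, hc, e, redMod_apply, hΨ, smul_eq_mul, mul_comm]
    have h2 : redMod R _ (∑ j, star (c j) • v j) ∈ redSpan (List.ofFn v) ⊓ redSub L := by
      refine ⟨?_, hL.redMod_mem hε hs⟩
      rw [map_sum]
      refine Submodule.sum_mem _ fun j _ => ?_
      rw [LinearMap.map_smulₛₗ]
      exact Submodule.smul_mem _ _ (redMod_mem_redSpan (List.mem_ofFn.2 ⟨j, rfl⟩))
    rw [hd, Submodule.mem_bot] at h2
    refine hf0 (LinearMap.pi_ext' fun j => LinearMap.ext_ring ?_)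
    simpa [← hc] using residue_eq_zero_of_redMod_sum_star hv h2 j
  -- Surjectivity modulo `𝔪` lifts by Nakayama's lemma.
  have h2 : (⊤ : Submodule R (Fin k → R)) ≤ L.map Ψ := by
    refine Submodule.le_of_le_smul_of_le_jacobson_bot (I := maximalIdeal R) Module.Finite.fg_top
      (IsLocalRing.maximalIdeal_le_jacobson _) ?_
    intro x _
    obtain ⟨y, hy, hyx⟩ : redMod R _ x ∈ (L.map Ψ).map (redMod R (Fin k)) := h1 ▸ trivial
    have e : x = y + (x - y) := by abel
    rw [e]
    refine Submodule.add_mem_sup hy ?_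
    rw [pi_eq_sum_univ' (x - y)]
    refine Submodule.sum_mem _ fun i _ => Submodule.smul_mem_smul ?_ trivial
    rw [← residue_eq_zero_iff, Pi.sub_apply, map_sub, sub_eq_zero]
    exact (congrFun hyx i).symm
  obtain ⟨y, hy, hyb⟩ := h2 (trivial : b ∈ (⊤ : Submodule R (Fin k → R)))
  exact ⟨y, hy, fun j => congrFun hyb j⟩

/-- The orthogonal complement of a transverse frame in a Lagrangian commutes with reduction. -/
theorem IsLagrangian.exists_redMod_eq (hL : IsLagrangian Λ L) (hε : ε * star ε = 1)
    {v : List (Fin (2 * n) → R)} (hv : RedIndep v) (hd : redSpan v ⊓ redSub L = ⊥)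
    {y' : Fin (2 * n) → ResidueField R} (hy' : y' ∈ redSub L ⊓ redPerp ε v) :
    ∃ y ∈ L, (∀ x ∈ v, hypForm ε x y = 0) ∧ redMod R _ y = y' := by
  classical
  obtain ⟨k, v, rfl⟩ : ∃ (k : ℕ) (w : Fin k → Fin (2 * n) → R), v = List.ofFn w :=
    ⟨_, v.get, (List.ofFn_get v).symm⟩
  obtain ⟨⟨y, hy, rfl⟩, hp⟩ := hy'
  choose g hgL hg using fun i : Fin k =>
    hL.exists_hypForm_eq hε ((redIndep_ofFn v).1 hv) hd (Pi.single i 1)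
  -- The `g i` in `L` are dual to the `v i`; the correction has coefficients in `𝔪`, so the
  -- reduction of `y` is unchanged.
  refine ⟨y - ∑ i, hypForm ε (v i) y • g i,
    L.sub_mem hy (Submodule.sum_mem _ fun i _ => L.smul_mem _ (hgL i)), ?_, ?_⟩
  · intro x hx
    obtain ⟨j, rfl⟩ := List.mem_ofFn.1 hx
    rw [← hypFormLin_apply, map_sub, map_sum]
    simp [hg, Pi.single_apply]
  · rw [map_sub, map_sum, Finset.sum_eq_zero, sub_zero]
    intro i _
    have := mem_redPerp.1 hp (v i) (List.mem_ofFn.2 ⟨i, rfl⟩)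
    rw [hypDual_redMod] at this
    rw [LinearMap.map_smulₛₗ, this, zero_smul]

/-- Finitely many frames that consist of vectors of a Lagrangian, followed by a fixed frame
transverse to it, can be coned off simultaneously by a vector of the Lagrangian. -/
theorem IsLagrangian.exists_forall_isFrameList_cons [Infinite (ResidueField R)]
    (hL : IsLagrangian Λ L) (hε : ε * star ε = 1) {v : List (Fin (2 * n) → R)} (hv : RedIndep v)
    (hd : redSpan v ⊓ redSub L = ⊥) (T : Finset (List (Fin (2 * n) → R)))
    (hT : ∀ l ∈ T, IsFrameList Λ l ∧ l.length < n ∧ ∃ u, l = u ++ v ∧ ∀ x ∈ u, x ∈ L) :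
    ∃ w ∈ L, ∀ l ∈ T, IsFrameList Λ (w :: l) := by
  classical
  let M : Submodule R (Fin (2 * n) → R) := L ⊓ ⨅ x ∈ v, LinearMap.ker (hypFormLin ε x)
  have hM : ∀ y, y ∈ M ↔ y ∈ L ∧ ∀ x ∈ v, hypForm ε x y = 0 := by
    intro y
    simp [M, Submodule.mem_iInf]
  have key : ∀ l ∈ T, ∃ y ∈ M, redMod R _ y ∉ redSpan l := by
    intro l hl
    by_contra! hcon
    obtain ⟨-, hlen, u, rfl, hu⟩ := hT l hl
    -- The component in `redSpan v` also lies in the reduction of `L`, so it vanishes by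
    -- transversality. The inclusion would force `n - |v| ≤ |u|`.
    have h1 : redSub L ⊓ redPerp ε v ≤ redSpan u := by
      intro y' hy'
      obtain ⟨y, hyL, hyv, rfl⟩ := hL.exists_redMod_eq hε hv hd hy'
      have h2 := redSpan_append _ _ (hcon y ((hM y).2 ⟨hyL, hyv⟩))
      obtain ⟨p, hp, q, hq, hpq⟩ := Submodule.mem_sup.1 h2
      have hpL : p ∈ redSub L := redSpan_le (fun x hx => Submodule.mem_map_of_mem (hu x hx)) hp
      have hqL : q ∈ redSpan v ⊓ redSub L := by
        refine ⟨hq, ?_⟩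
        rw [← add_sub_cancel_left p q, hpq]
        exact Submodule.sub_mem _ hy'.1 hpL
      rw [hd, Submodule.mem_bot] at hqL
      rw [← hpq, hqL, add_zero]
      exact hp
    have h2 := Submodule.finrank_mono h1
    have h3 := finrank_redSpan_le u
    have h4 := finrank_le_finrank_inf_redPerp ε (redSub L) v
    have h5 := hL.le_finrank
    rw [List.length_append] at hlen
    omega
  have key' : ∀ l, ∃ f : M →ₗ[R] ResidueField R, l ∈ T → (∃ z, f z ≠ 0) ∧
      ∀ z : M, f z ≠ 0 → redMod R _ (z : Fin (2 * n) → R) ∉ redSpan l := by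
    intro l
    by_cases hl : l ∈ T
    swap
    · exact ⟨0, fun h => absurd h hl⟩
    obtain ⟨y, hy, hyl⟩ := key l hl
    obtain ⟨φ, hφ, hφl⟩ := Submodule.exists_le_ker_of_notMem hyl
    refine ⟨{ toFun := fun z => φ (redMod R _ (z : Fin (2 * n) → R))
              map_add' := fun a b => by simp
              map_smul' := fun c a => by
                rw [Submodule.coe_smul, LinearMap.map_smulₛₗ, map_smul, RingHom.id_apply,
                  Algebra.smul_def c, ResidueField.algebraMap_eq, smul_eq_mul] },
      fun _ => ⟨⟨⟨y, hy⟩, hφ⟩, fun z hz hzl => hz (hφl hzl)⟩⟩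
  choose f hf using key'
  obtain ⟨⟨w, hwM⟩, hw⟩ := exists_forall_apply_ne_zero T f fun l hl => (hf l hl).1
  obtain ⟨hwL, hwv⟩ := (hM w).1 hwM
  refine ⟨w, hwL, fun l hl => ?_⟩
  obtain ⟨hlF, -, u, hluv, hu⟩ := hT l hl
  have hlw : ∀ x ∈ l, hypForm ε x w = 0 := by
    intro x hx
    rw [hluv] at hx
    rcases List.mem_append.1 hx with h | h
    · exact hL.form x (hu x h) w hwL
    · exact hwv x h
  refine ⟨⟨(hf l hl).2 ⟨w, hwM⟩ (hw l hl), hlF.indep⟩, ?_, ?_⟩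
  · intro x hx
    rcases List.mem_cons.1 hx with rfl | h
    · exact hL.quad _ hwL
    · exact hlF.quad x h
  · intro x hx y hy
    rcases List.mem_cons.1 hx with rfl | h <;> rcases List.mem_cons.1 hy with rfl | h'
    · exact hL.form _ hwL _ hwL
    · exact hypForm_eq_zero_comm hε (hlw y h')
    · exact hlw x h
    · exact hlF.form x h y h'

theorem isFrameList_of_mem_support {k : ℕ} {c : FrameChain (isotropicUnimodularPoset Λ n) k}
    {l : List (Fin (2 * n) → R)} (hl : l ∈ (frameChainToList _ k c).support) :
    IsFrameList Λ l ∧ l.length = k + 1 := by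
  classical
  obtain ⟨v, -, rfl⟩ := Finset.mem_image.1 (Finsupp.mapDomain_support hl)
  exact ⟨(isFrameList_ofFn v.1).2 v.2, by simp [FrameSimplex.toList]⟩

end Cones

/-! ### Acyclicity of the poset of isotropic unimodular frames -/

theorem theorem2p5 {R : Type*} [CommRing R] [StarRing R] [IsLocalRing R]
    [Infinite (IsLocalRing.ResidueField R)] (ε : R) (hε : ε * star ε = 1)
    (Λ : FormParameter R ε) (n : ℕ) :
    IsFrameAcyclic (isotropicUnimodularPoset Λ n) ((n : ℤ) - 2) := by
  classical
  intro k hk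
  rw [Submodule.Quotient.subsingleton_iff, eq_top_iff]
  rintro ⟨c, hc⟩ -
  rw [Submodule.submoduleOf, Submodule.mem_comap, Submodule.subtype_apply]
  set z := frameChainToList _ k c with hz
  -- All sublists are included, since faces of the frames in `G` below may drop entries outside `L`.
  let F : Finset (List (Fin (2 * n) → R)) := z.support.biUnion fun l => l.sublists.toFinset
  have hF : ∀ {v}, v ∈ F ↔ ∃ l ∈ z.support, v.Sublist l := by simp [F]
  have hFF : ∀ v ∈ F, IsFrameList Λ v ∧ v.length < n := by
    intro v hv
    obtain ⟨l, hl, hs⟩ := hF.1 hv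
    obtain ⟨h1, h2⟩ := isFrameList_of_mem_support hl
    have := hs.length_le
    exact ⟨h1.sublist hs, by omega⟩
  obtain ⟨L, hL, hd⟩ := exists_isLagrangian_forall_inf_eq_bot Λ hε (by omega) F
    fun v hv => (hFF v hv).2
  have hvL : ∀ v ∈ F, ∀ x ∈ v, x ∉ L := by
    intro v hv x hx hxL
    have : redMod R _ x ∈ redSpan v ⊓ redSub L :=
      ⟨redMod_mem_redSpan hx, x, hxL, rfl⟩
    rw [hd v hv, Submodule.mem_bot] at this
    exact (hFF v hv).1.indep.redMod_ne_zero hx this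
  -- The cycle starts with `u = []` and cones only prepend vectors of `L`, so this shape persists.
  -- By transversality no entry of `v` lies in `L`, so `v` is recovered by filtering.
  let G : Set (List (Fin (2 * n) → R)) :=
    {l | IsFrameList Λ l ∧ ∃ u v, l = u ++ v ∧ (∀ x ∈ u, x ∈ L) ∧ v ∈ F}
  have hG : ∀ l ∈ G, ∀ l' : List (Fin (2 * n) → R), l'.Sublist l → l' ∈ G := by
    rintro l ⟨hl, u, v, rfl, hu, hv⟩ l' hs
    obtain ⟨u', v', rfl, hu', hv'⟩ := List.sublist_append_iff.1 hs
    obtain ⟨m, hm, hvm⟩ := hF.1 hv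
    exact ⟨hl.sublist hs, u', v', rfl, fun x hx => hu x (hu'.subset hx),
      hF.2 ⟨m, hm, hv'.trans hvm⟩⟩
  have hfilter : ∀ u v : List (Fin (2 * n) → R), (∀ x ∈ u, x ∈ L) → v ∈ F →
      (u ++ v).filter (fun x => ¬ x ∈ L) = v := by
    intro u v hu hv
    rw [List.filter_append, List.filter_eq_nil_iff.2 (by simpa using hu),
      List.filter_eq_self.2 (by simpa using hvL v hv), List.nil_append]
  have hcone : ∀ (v : List (Fin (2 * n) → R)) (T : Finset (List (Fin (2 * n) → R))),
      (∀ l ∈ T, l ∈ G ∧ l.length = k + 1 ∧ l.filter (fun x => ¬ x ∈ L) = v) →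
        ∃ w, w ∈ L ∧ ∀ l ∈ T, w :: l ∈ G := by
    intro v T hT
    rcases T.eq_empty_or_nonempty with rfl | ⟨l₀, hl₀⟩
    · exact ⟨0, L.zero_mem, by simp⟩
    have hvF : v ∈ F := by
      obtain ⟨⟨-, u, v', rfl, hu, hv'⟩, -, hv⟩ := hT l₀ hl₀
      rw [hfilter u v' hu hv'] at hv
      exact hv ▸ hv'
    obtain ⟨w, hwL, hw⟩ := hL.exists_forall_isFrameList_cons hε (hFF v hvF).1.indep (hd v hvF) T
      (by
        intro l hl
        obtain ⟨⟨hlF, u, v', rfl, hu, hv'⟩, hlen, hv⟩ := hT l hl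
        rw [hfilter u v' hu hv'] at hv
        subst hv
        exact ⟨hlF, by omega, u, rfl, hu⟩)
    refine ⟨w, hwL, fun l hl => ⟨hw l hl, ?_⟩⟩
    obtain ⟨⟨-, u, v', rfl, hu, hv'⟩, -⟩ := hT l hl
    exact ⟨w :: u, v', rfl, List.forall_mem_cons.2 ⟨hwL, hu⟩, hv'⟩
  have hzG : z ∈ Finsupp.supported ℤ ℤ {l | l ∈ G ∧ l.length = k + 1} := by
    rw [Finsupp.mem_supported]
    intro l hl
    obtain ⟨h1, h2⟩ := isFrameList_of_mem_support hl
    exact ⟨⟨h1, [], l, rfl, by simp, hF.2 ⟨l, hl, List.Sublist.refl l⟩⟩, h2⟩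
  obtain ⟨y, hy, hyc⟩ := exists_listBoundary_eq (fun x => x ∈ L) (k + 1) hG
    (by convert hcone) hzG (listBoundary_eq_zero_of_mem_frameCycles hc)
  refine mem_frameBoundaries_of_listBoundary_eq (Finsupp.supported_mono ?_ hy) hyc
  rintro l ⟨hl, hlen⟩
  exact mem_range_toList_of_isFrameList hl.1 hlen
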